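/- Let $E=\mathbb C^d$ and $F=\mathbb C^r$ with their standard Hermitian inner products, and write $\mathbf e_\zeta(z):=e^{\zeta^*z}$. Let $K_0\subset E$ be a compact absolutely convex neighbourhood of $0$ (i.e. $ax+by\in K_0$ whenever $x,y\in K_0$, $a,b\in\mathbb C$, $|a|+|b|\le1$), let $p\in E$, $K:=p+K_0$, and let $f$ be a map from $K$ to $F$ which is holomorphic on a neighbourhood of $K$. Put $|z|_{K_0}:=\inf\{t>0: z\in tK_0\}$. *The matrix $\mathbf C_m$.* For a compact or open set $S\subset\mathbb C^k$ let $\mathcal O(S)$ be the space of germs along $S$ of holomorphic functions (with its inductive limit topology), $\mathcal O(S)'$ its dual, and $f_*:\mathcal O(K)'\to\mathcal O(F)'$, $(f_*\varphi)(h):=\varphi(h\circ f)$, the push-forward. For $\varphi\in\mathcal O(S)'$ put $\overline{\mathbf{FB}}(\varphi)(\zeta):=\overline{\varphi(\mathbf e_\zeta)}$. Let $\mathfrak D_{p,m}\subset\mathcal O(K)'$ be the span of the functionals $h\mapsto(\partial^\alpha h)(p)$, $|\alpha|\le m$, and $\widetilde{\mathfrak D}_{p,m}:=\overline{\mathbf{FB}}(\mathfrak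 D_{p,m})$; likewise $\mathfrak D_{f(p),m}\subset\mathcal O(F)'$ and $\widetilde{\mathfrak D}_{f(p),m}$. Then $\overline{\mathbf{FB}}$ is injective on these spaces, $f_*$ maps $\mathfrak D_{p,m}$ into $\mathfrak D_{f(p),m}$, and the functions $$u_{p,\alpha}(z)=\frac{e^{-\|p\|^2/2}}{\sqrt{\alpha!}}(z-p)^\alpha\mathbf e_p(z)\ (|\alpha|\le m),\qquad v_{q,\beta}(w)=\frac{e^{-\|q\|^2/2}}{\sqrt{\beta!}}(w-q)^\beta\mathbf e_q(w)\ (|\beta|\le m,\ q=f(p)),$$ form bases of $\widetilde{\mathfrak D}_{p,m}$ and $\widetilde{\mathfrak D}_{f(p),m}$. Let $\mathbf C_m$ be the matrix of $\overline{\mathbf{FB}}\circ f_*\circ\overline{\mathbf{FB}}^{-1}:\widetilde{\mathfrak D}_{p,m}\to\widetilde{\mathfrak D}_{f(p),m}$ with respect to these bases. *The matrix $\widehat{\mathbf C}_{m,n,Z}$.* For $m\le n$ and $Z=(z^1,\dots,z^N)\in K^N$ let $\mathbf U:=(u_{p,\alpha}(z^k))_{1\le k\le N,\ |\alpha|\le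 n}$ and $\mathbf V:=(v_{f(p),\beta}(f(z^k)))_{1\le k\le N,\ |\beta|\le m}$, and let $\widehat{\mathbf C}_{m,n,Z}$ consist of the columns with index $|\alpha|\le m$ of $\mathbf V^*(\mathbf U^*)^\dagger$, where $\dagger$ is the Moore–Penrose pseudo-inverse. *The sampling measure.* Let $\mu$ be a Borel probability measure on $K_0$ with $\operatorname{supp}\mu\subset\operatorname{int}K_0$. Put $R_\mu:=\sup_{x\in\operatorname{supp}\mu}|x|_{K_0}$, $L_\mu:=\max(1,\sup_{z\in\operatorname{supp}\mu}\max_i|z_i|)$, $r_n^E:=\#\{\alpha\in\mathbb Z_{\ge0}^d:|\alpha|\le n\}$, let $\mathbf D_n(\mu):=\big(\int\overline{x^\alpha}x^\beta\,d\mu(x)\big)_{|\alpha|,|\beta|\le n}$ (equal to $\big(\int x^{\alpha+\beta}d\mu\big)_{\alpha,\beta}$ when $\mu$ is carried by $\mathbb R^d$), and let $\Lambda_n(\mu)$ be its smallest eigenvalue. **Claim.** There is a constant $C>0$ depending only on $f,p,K_0,\mu$ such that the following holds for all integers $0\le m\le n$ for which $\mathbf D_n(\mu)$ is invertible, all $\delta\in(0,1)$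 and all $N\in\mathbb Z_{\ge0}$ with $$N\ \ge\ \frac{L_\mu^{4n}(r_n^E)^2}{\Lambda_n(\mu)^2}\cdot4\log(2/\delta).$$ If $z_0^1,\dots,z_0^N$ are i.i.d. random variables with law $\mu$ and $Z_N:=(p+z_0^1,\dots,p+z_0^N)$, then with probability at least $1-\delta$ $$\big\|\mathbf C_m-\widehat{\mathbf C}_{m,n,Z_N}\big\|_{\rm Fr}\ \le\ C\,\sqrt{2\,m!}\;\frac{R_\mu^n}{\Lambda_n(\mu)^{1/2}}.$$ -/

import Mathlib

open Filter Topology MeasureTheory ProbabilityTheory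
open scoped Pointwise

noncomputable section

namespace FockPushforward

/-! ### Holomorphic germs, analytic functionals and push-forwards -/

/-- The Hermitian space `ℂ^d`. -/
abbrev CSpace (d : ℕ) : Type := EuclideanSpace ℂ (Fin d)

/-- `𝒪(S)`: germs along `S` of functions which are holomorphic on a neighbourhood of `S`. For `S = ℂ^d`
this is the space of entire functions. -/
def HolGerm {d : ℕ} (S : Set (CSpace d)) : Submodule ℂ (Germ (𝓝ˢ S) ℂ) where
  carrier := {g | ∃ h : CSpace d → ℂ, AnalyticOnNhd ℂ h S ∧ (h : Germ (𝓝ˢ S) ℂ) = g}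
  add_mem' := by
    rintro _ _ ⟨h, hh, rfl⟩ ⟨k, hk, rfl⟩
    exact ⟨h + k, hh.add hk, rfl⟩
  zero_mem' := ⟨0, analyticOnNhd_const, rfl⟩
  smul_mem' := by
    rintro c _ ⟨h, hh, rfl⟩
    exact ⟨c • h, fun z hz => (hh z hz).const_smul, rfl⟩

/-- The class in `𝒪(S)` of a function holomorphic near `S`. -/
def HolGerm.mk {d : ℕ} {S : Set (CSpace d)} (h : CSpace d → ℂ) (hh : AnalyticOnNhd ℂ h S) :
    HolGerm S :=
  ⟨(h : Germ (𝓝ˢ S) ℂ), h, hh, rfl⟩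

theorem HolGerm.exists_rep {d : ℕ} {S : Set (CSpace d)} (g : HolGerm S) :
    ∃ (h : CSpace d → ℂ) (hh : AnalyticOnNhd ℂ h S), g = HolGerm.mk h hh := by
  obtain ⟨_, h, hh, rfl⟩ := g
  exact ⟨h, hh, rfl⟩

/-- Continuity of a linear functional on `𝒪(S)` for the inductive limit of the spaces `𝒪(U)`, where `U` runs
over the open neighbourhoods of `S` and `𝒪(U)` carries the topology of uniform convergence on
compact subsets of `U`: the restriction to each `𝒪(U)` is bounded by a multiple of the supremum over some
compact subset `L` of `U`. -/
def IsContinuousFunctional {d : ℕ} {S : Set (CSpace d)} (φ : HolGerm S →ₗ[ℂ] ℂ) : Prop :=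
  ∀ (U : Set (CSpace d)), IsOpen U → ∀ hSU : S ⊆ U,
    ∃ L : Set (CSpace d), IsCompact L ∧ L ⊆ U ∧ ∃ C : ℝ, 0 ≤ C ∧
      ∀ (h : CSpace d → ℂ) (hh : AnalyticOnNhd ℂ h U) (M : ℝ), 0 ≤ M → (∀ z ∈ L, ‖h z‖ ≤ M) →
        ‖φ (HolGerm.mk h (hh.mono hSU))‖ ≤ C * M

/-- `𝒪(S)'`: the space of analytic functionals, the topological dual of `𝒪(S)`. -/
def AnalyticFunctional {d : ℕ} (S : Set (CSpace d)) : Submodule ℂ (HolGerm S →ₗ[ℂ] ℂ) where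
  carrier := {φ | IsContinuousFunctional φ}
  add_mem' := by
    intro φ ψ hφ hψ U hU hSU
    obtain ⟨L, hL, hLU, C, hC, h1⟩ := hφ U hU hSU
    obtain ⟨L', hL', hLU', C', hC', h2⟩ := hψ U hU hSU
    refine ⟨L ∪ L', hL.union hL', Set.union_subset hLU hLU', C + C', add_nonneg hC hC', ?_⟩
    intro h hh M hM hb
    have e1 := h1 h hh M hM fun z hz => hb z (Or.inl hz)
    have e2 := h2 h hh M hM fun z hz => hb z (Or.inr hz)
    calc _ ≤ ‖φ (HolGerm.mk h (hh.mono hSU))‖ + ‖ψ (HolGerm.mk h (hh.mono hSU))‖ := norm_add_le _ _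
      _ ≤ (C + C') * M := by linarith
  zero_mem' := by
    intro U hU hSU
    exact ⟨∅, isCompact_empty, Set.empty_subset _, 0, le_rfl, by simp⟩
  smul_mem' := by
    intro c φ hφ U hU hSU
    obtain ⟨L, hL, hLU, C, hC, h1⟩ := hφ U hU hSU
    refine ⟨L, hL, hLU, ‖c‖ * C, by positivity, ?_⟩
    intro h hh M hM hb
    have e1 := h1 h hh M hM hb
    calc ‖(c • φ) (HolGerm.mk h (hh.mono hSU))‖
        = ‖c‖ * ‖φ (HolGerm.mk h (hh.mono hSU))‖ := by simp
      _ ≤ ‖c‖ * (C * M) := by gcongr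
      _ = ‖c‖ * C * M := by ring

/-- The pull-back `f^* : 𝒪(ℂ^r) → 𝒪(S)`, `h ↦ h ∘ f`, of a map `f` holomorphic near `S`. -/
def pullback {d r : ℕ} {S : Set (CSpace d)} (f : CSpace d → CSpace r) (hf : AnalyticOnNhd ℂ f S) :
    HolGerm (Set.univ : Set (CSpace r)) →ₗ[ℂ] HolGerm S where
  toFun g := ⟨g.1.compTendsto f (by simp), by
    obtain ⟨h, hh, rfl⟩ := HolGerm.exists_rep g
    exact ⟨h ∘ f, fun z hz => (hh (f z) (Set.mem_univ _)).comp (hf z hz), rfl⟩⟩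
  map_add' := by
    intro g g'
    obtain ⟨h, hh, rfl⟩ := HolGerm.exists_rep g
    obtain ⟨h', hh', rfl⟩ := HolGerm.exists_rep g'
    rfl
  map_smul' := by
    intro c g
    obtain ⟨h, hh, rfl⟩ := HolGerm.exists_rep g
    rfl

theorem pullback_mk {d r : ℕ} {S : Set (CSpace d)} (f : CSpace d → CSpace r)
    (hf : AnalyticOnNhd ℂ f S) (h : CSpace r → ℂ) (hh : AnalyticOnNhd ℂ h Set.univ) :
    pullback f hf (HolGerm.mk h hh) =
      HolGerm.mk (h ∘ f) (fun z hz => (hh (f z) (Set.mem_univ _)).comp (hf z hz)) := rfl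

/-- The push-forward `f_* : 𝒪(S)' → 𝒪(ℂ^r)'`, the dual map of the pull-back: `(f_* φ)(h) = φ(h ∘ f)`. -/
def pushforward {d r : ℕ} {S : Set (CSpace d)} (f : CSpace d → CSpace r)
    (hf : AnalyticOnNhd ℂ f S) :
    AnalyticFunctional S →ₗ[ℂ] AnalyticFunctional (Set.univ : Set (CSpace r)) where
  toFun φ := ⟨φ.1 ∘ₗ pullback f hf, by
    intro V hV hVu
    obtain ⟨L, hL, hLU, C, hC, h1⟩ := φ.2 {z | AnalyticAt ℂ f z} (isOpen_analyticAt ℂ f) hf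
    refine ⟨f '' L, hL.image_of_continuousOn
      (fun z hz => (hLU hz).continuousAt.continuousWithinAt), fun _ _ => hVu (Set.mem_univ _),
      C, hC, ?_⟩
    intro h hh M hM hb
    exact h1 (h ∘ f) (fun z hz => (hh (f z) (hVu (Set.mem_univ _))).comp hz) M hM
      fun z hz => hb _ (Set.mem_image_of_mem f hz)⟩
  map_add' _ _ := rfl
  map_smul' _ _ := rfl

/-! ### The Fourier--Borel transform -/

/-- `e_ζ(z) = exp(ζ^* z)`; Mathlib's inner product is conjugate linear in its first entry. -/
def expFun {d : ℕ} (ζ : CSpace d) (z : CSpace d) : ℂ := Complex.exp (inner ℂ ζ z)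

theorem expFun_analytic {d : ℕ} (ζ : CSpace d) (S : Set (CSpace d)) :
    AnalyticOnNhd ℂ (expFun ζ) S :=
  fun z _ => ((innerSL ℂ ζ).analyticAt z).cexp

/-- The (conjugated) Fourier--Borel transform `φ ↦ (ζ ↦ conj (φ(e_ζ)))`, an antilinear map. -/
def fourierBorel {d : ℕ} (S : Set (CSpace d)) :
    AnalyticFunctional S →ₛₗ[starRingEnd ℂ] (CSpace d → ℂ) where
  toFun φ := fun ζ => starRingEnd ℂ (φ.1 (HolGerm.mk (expFun ζ) (expFun_analytic ζ S)))
  map_add' φ ψ := by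
    funext ζ
    simp
  map_smul' c φ := by
    funext ζ
    simp

/-! ### Partial derivatives and jet functionals -/

/-- The complex partial derivative `∂_{z_i} h`. -/
def pd {d : ℕ} (i : Fin d) (h : CSpace d → ℂ) : CSpace d → ℂ :=
  fun z => fderiv ℂ h z (EuclideanSpace.single i 1)

/-- Iterated partial derivatives along a list of coordinates. -/
def pdList {d : ℕ} (l : List (Fin d)) (h : CSpace d → ℂ) : CSpace d → ℂ := l.foldr pd h

/-- The list `0, …, 0, 1, …, 1, …` in which `i` is repeated `α i` times. -/
def coordList {d : ℕ} (α : Fin d → ℕ) : List (Fin d) :=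
  (List.finRange d).flatMap fun i => List.replicate (α i) i

/-- `∂^α h = ∂_{z_1}^{α_1} ⋯ ∂_{z_d}^{α_d} h`. -/
def multiDeriv {d : ℕ} (α : Fin d → ℕ) (h : CSpace d → ℂ) : CSpace d → ℂ :=
  pdList (coordList α) h

theorem pd_analyticAt {d : ℕ} (i : Fin d) {h : CSpace d → ℂ} {z : CSpace d}
    (hh : AnalyticAt ℂ h z) : AnalyticAt ℂ (pd i h) z :=
  ((ContinuousLinearMap.apply ℂ ℂ (EuclideanSpace.single i (1 : ℂ))).analyticAt _).comp hh.fderiv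

theorem pdList_analyticAt {d : ℕ} (l : List (Fin d)) {h : CSpace d → ℂ} {z : CSpace d}
    (hh : AnalyticAt ℂ h z) : AnalyticAt ℂ (pdList l h) z := by
  induction l with
  | nil => exact hh
  | cons i l ih => exact pd_analyticAt i ih

theorem pd_congr {d : ℕ} (i : Fin d) {h k : CSpace d → ℂ} {z : CSpace d} (e : h =ᶠ[𝓝 z] k) :
    pd i h =ᶠ[𝓝 z] pd i k := by
  filter_upwards [e.fderiv (𝕜 := ℂ)] with w hw
  simp [pd, hw]

theorem pdList_congr {d : ℕ} (l : List (Fin d)) {h k : CSpace d → ℂ} {z : CSpace d}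
    (e : h =ᶠ[𝓝 z] k) : pdList l h =ᶠ[𝓝 z] pdList l k := by
  induction l with
  | nil => exact e
  | cons i l ih => exact pd_congr i ih

theorem pdList_add {d : ℕ} (l : List (Fin d)) {h k : CSpace d → ℂ} {z : CSpace d}
    (hh : AnalyticAt ℂ h z) (hk : AnalyticAt ℂ k z) :
    pdList l (h + k) =ᶠ[𝓝 z] pdList l h + pdList l k := by
  induction l with
  | nil => exact EventuallyEq.rfl
  | cons i l ih =>
    refine (pd_congr i ih).trans ?_
    filter_upwards [(pdList_analyticAt l hh).eventually_analyticAt,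
      (pdList_analyticAt l hk).eventually_analyticAt] with w h1 h2
    change fderiv ℂ (pdList l h + pdList l k) w _ = fderiv ℂ (pdList l h) w _ + fderiv ℂ (pdList l k) w _
    rw [fderiv_add h1.differentiableAt h2.differentiableAt]
    rfl

theorem pdList_smul {d : ℕ} (l : List (Fin d)) (c : ℂ) {h : CSpace d → ℂ} {z : CSpace d}
    (hh : AnalyticAt ℂ h z) :
    pdList l (c • h) =ᶠ[𝓝 z] c • pdList l h := by
  induction l with
  | nil => exact EventuallyEq.rfl
  | cons i l ih =>
    refine (pd_congr i ih).trans ?_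
    filter_upwards [(pdList_analyticAt l hh).eventually_analyticAt] with w h1
    change fderiv ℂ (c • pdList l h) w _ = c • fderiv ℂ (pdList l h) w _
    rw [fderiv_const_smul h1.differentiableAt]
    rfl

/-- Cauchy estimate for iterated partial derivatives. -/
theorem pdList_bound {d : ℕ} (l : List (Fin d)) (p : CSpace d) {ε : ℝ} (hε : 0 < ε) :
    ∃ ρ C : ℝ, 0 < ρ ∧ ρ ≤ ε ∧ 0 ≤ C ∧ ∀ (h : CSpace d → ℂ) (M : ℝ),
      AnalyticOnNhd ℂ h (Metric.closedBall p ε) → 0 ≤ M →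
      (∀ z ∈ Metric.closedBall p ε, ‖h z‖ ≤ M) →
      ∀ z ∈ Metric.closedBall p ρ, ‖pdList l h z‖ ≤ C * M := by
  induction l with
  | nil => exact ⟨ε, 1, hε, le_rfl, zero_le_one, fun h M _ _ hb z hz => by simpa [pdList] using hb z hz⟩
  | cons i l ih =>
    obtain ⟨ρ, C, hρ, hρε, hC, H⟩ := ih
    refine ⟨ρ / 2, C / (ρ / 2), by positivity, by linarith, by positivity, ?_⟩
    intro h M hh hM hb z hz
    have H' := H h M hh hM hb
    set g := pdList l h with hg
    set v : CSpace d := EuclideanSpace.single i 1 with hv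
    have hvn : ‖v‖ = 1 := by simp [hv]
    have hmem : ∀ t ∈ Metric.closedBall (0 : ℂ) (ρ / 2), z + t • v ∈ Metric.closedBall p ρ := by
      intro t ht
      rw [mem_closedBall_iff_norm] at *
      calc ‖z + t • v - p‖ = ‖(z - p) + t • v‖ := by congr 1; abel
        _ ≤ ‖z - p‖ + ‖t • v‖ := norm_add_le _ _
        _ ≤ ρ / 2 + ρ / 2 := by
          refine add_le_add hz ?_
          rw [norm_smul, hvn, mul_one]
          simpa using ht
        _ = ρ := by ring
    have han : ∀ t ∈ Metric.closedBall (0 : ℂ) (ρ / 2),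
        DifferentiableAt ℂ (fun t : ℂ => g (z + t • v)) t := by
      intro t ht
      have : AnalyticAt ℂ g (z + t • v) :=
        pdList_analyticAt l (hh _ (Metric.closedBall_subset_closedBall hρε (hmem t ht)))
      exact this.differentiableAt.comp t (by fun_prop)
    have hd : deriv (fun t : ℂ => g (z + t • v)) 0 = pd i g z := by
      have hz0 : DifferentiableAt ℂ g z := by
        have := pdList_analyticAt l (hh _ (Metric.closedBall_subset_closedBall hρε
          (hmem 0 (by simp; positivity))))
        simpa using this.differentiableAt
      have := hz0.lineDeriv_eq_fderiv (v := v)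
      simpa [lineDeriv, pd] using this
    have hcl : closure (Metric.ball (0 : ℂ) (ρ / 2)) = Metric.closedBall 0 (ρ / 2) :=
      closure_ball _ (by positivity)
    have hdc : DiffContOnCl ℂ (fun t : ℂ => g (z + t • v)) (Metric.ball 0 (ρ / 2)) := by
      refine DifferentiableOn.diffContOnCl ?_
      rw [hcl]
      exact fun t ht => (han t ht).differentiableWithinAt
    have := Complex.norm_deriv_le_of_forall_mem_sphere_norm_le (C := C * M) (by positivity) hdc
      fun t ht => H' _ (hmem t (Metric.sphere_subset_closedBall ht))
    rw [hd] at this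
    calc ‖pdList (i :: l) h z‖ = ‖pd i g z‖ := rfl
      _ ≤ C * M / (ρ / 2) := this
      _ = C / (ρ / 2) * M := by ring

/-- The functional `δ_p^α : h ↦ (∂^α h)(p)` as an element of `𝒪(S)'`, for `p ∈ S`. -/
def jetFunctional {d : ℕ} {S : Set (CSpace d)} {p : CSpace d} (hp : p ∈ S) (α : Fin d → ℕ) :
    AnalyticFunctional S :=
  ⟨{ toFun := fun g => g.1.liftOn (fun h => multiDeriv α h p) (fun _ _ e =>
        (pdList_congr _ (e.filter_mono (nhds_le_nhdsSet hp))).eq_of_nhds)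
     map_add' := by
        intro g g'
        obtain ⟨h, hh, rfl⟩ := HolGerm.exists_rep g
        obtain ⟨h', hh', rfl⟩ := HolGerm.exists_rep g'
        exact (pdList_add (coordList α) (hh p hp) (hh' p hp)).eq_of_nhds
     map_smul' := by
        intro c g
        obtain ⟨h, hh, rfl⟩ := HolGerm.exists_rep g
        exact (pdList_smul (coordList α) c (hh p hp)).eq_of_nhds }, by
    intro U hU hSU
    obtain ⟨ε, hε, hεU⟩ := Metric.nhds_basis_closedBall.mem_iff.1 (hU.mem_nhds (hSU hp))
    obtain ⟨ρ, C, hρ, -, hC, H⟩ := pdList_bound (coordList α) p hε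
    exact ⟨Metric.closedBall p ε, isCompact_closedBall p ε, hεU, C, hC, fun h hh M hM hb =>
      H h M (hh.mono hεU) hM hb p (Metric.mem_closedBall_self hρ.le)⟩⟩

theorem jetFunctional_mk {d : ℕ} {S : Set (CSpace d)} {p : CSpace d} (hp : p ∈ S) (α : Fin d → ℕ)
    (h : CSpace d → ℂ) (hh : AnalyticOnNhd ℂ h S) :
    (jetFunctional hp α).1 (HolGerm.mk h hh) = multiDeriv α h p := rfl

/-- Multi-indices `α ∈ ℤ_{≥0}^d` with `|α| ≤ n`; they index the rows and columns of all matrices below. -/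
def MultiIdx (d n : ℕ) : Type := {α : Fin d → ℕ // ∑ i, α i ≤ n}

instance (d n : ℕ) : Fintype (MultiIdx d n) :=
  Fintype.subtype ((Fintype.piFinset fun _ : Fin d => Finset.range (n + 1)).filter
    fun α => ∑ i, α i ≤ n) (by
      intro α
      simp only [Finset.mem_filter, Fintype.mem_piFinset, Finset.mem_range, and_iff_right_iff_imp]
      intro h i
      have := Finset.single_le_sum (f := α) (fun _ _ => Nat.zero_le _) (Finset.mem_univ i)
      omega)

instance (d n : ℕ) : DecidableEq (MultiIdx d n) := fun a b =>
  decidable_of_iff (a.1 = b.1) Subtype.ext_iff.symm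

instance (d n : ℕ) : Nonempty (MultiIdx d n) := ⟨⟨0, by simp⟩⟩

/-- The inclusion of the multi-indices of length at most `m` into those of length at most `n`. -/
def MultiIdx.castLE {d m n : ℕ} (h : m ≤ n) (α : MultiIdx d m) : MultiIdx d n :=
  ⟨α.1, α.2.trans h⟩

/-- `𝔇_{p,n} ⊆ 𝒪(S)'`, the span of the functionals `δ_p^α` with `|α| ≤ n`. -/
def jetSpace {d : ℕ} {S : Set (CSpace d)} {p : CSpace d} (hp : p ∈ S) (n : ℕ) :
    Submodule ℂ (AnalyticFunctional S) :=
  Submodule.span ℂ (Set.range fun α : MultiIdx d n => jetFunctional hp α.1)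

/-- The image of `𝔇_{p,n}` under the Fourier--Borel transform, a space of entire functions. -/
def jetSpaceFB {d : ℕ} {S : Set (CSpace d)} {p : CSpace d} (hp : p ∈ S) (n : ℕ) :
    Submodule ℂ (CSpace d → ℂ) :=
  (jetSpace hp n).map (fourierBorel S)

/-- `u_{p,α}(z) = e^{-‖p‖²/2} (α!)^{-1/2} (z - p)^α e_p(z)`. -/
def fockBasisFun {d : ℕ} (p : CSpace d) (α : Fin d → ℕ) (z : CSpace d) : ℂ :=
  ((Real.exp (-‖p‖ ^ 2 / 2) / Real.sqrt (∏ i, (α i).factorial : ℕ) : ℝ) : ℂ) *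
    (∏ i, (z i - p i) ^ α i) * expFun p z

theorem pd_expFun {d : ℕ} (i : Fin d) (ζ : CSpace d) :
    pd i (expFun ζ) = starRingEnd ℂ (ζ i) • expFun ζ := by
  funext z
  have h : HasFDerivAt (expFun ζ) (Complex.exp (inner ℂ ζ z) • (innerSL ℂ ζ : CSpace d →L[ℂ] ℂ)) z :=
    (innerSL ℂ ζ).hasFDerivAt.cexp
  rw [pd, h.fderiv]
  simp [expFun, EuclideanSpace.inner_single_right, mul_comm]

theorem pdList_expFun {d : ℕ} (l : List (Fin d)) (ζ : CSpace d) :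
    pdList l (expFun ζ) = (l.map fun i => starRingEnd ℂ (ζ i)).prod • expFun ζ := by
  induction l with
  | nil => simp [pdList]
  | cons i l ih =>
    have h1 : pdList (i :: l) (expFun ζ) = pd i (pdList l (expFun ζ)) := rfl
    rw [h1, ih]
    funext z
    have := (pdList_smul [i] (l.map fun i => starRingEnd ℂ (ζ i)).prod
      (expFun_analytic ζ Set.univ z (Set.mem_univ _))).eq_of_nhds
    refine this.trans ?_
    change (_ • pd i (expFun ζ)) z = _
    rw [pd_expFun]
    simp only [Pi.smul_apply, smul_eq_mul, List.map_cons, List.prod_cons]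
    ring

theorem coordList_prod {d : ℕ} (α : Fin d → ℕ) (x : Fin d → ℂ) :
    ((coordList α).map x).prod = ∏ i, x i ^ α i := by
  rw [coordList, List.map_flatMap, List.flatMap, List.prod_flatten, List.map_map,
    ← List.prod_ofFn, List.ofFn_eq_map]
  congr 1
  refine List.map_congr_left fun i _ => ?_
  simp

theorem coordList_count {d : ℕ} (α : Fin d → ℕ) (i : Fin d) : (coordList α).count i = α i := by
  rw [coordList, List.count_flatMap, ← List.ofFn_eq_map, List.sum_ofFn]
  simp [List.count_replicate]

theorem list_perm_coordList {d : ℕ} (l : List (Fin d)) :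
    l.Perm (coordList fun i => l.count i) := by
  rw [List.perm_iff_count]
  intro i
  rw [coordList_count]

theorem list_sum_count {d : ℕ} (l : List (Fin d)) : ∑ i, l.count i = l.length := by
  induction l with
  | nil => simp
  | cons a l ih => simp [List.count_cons, Finset.sum_add_distrib, ih]

theorem coordList_length {d : ℕ} (α : Fin d → ℕ) : (coordList α).length = ∑ i, α i := by
  rw [← list_sum_count]
  simp [coordList_count]

/-- The transform of `δ_p^α` is `ζ ↦ ζ^α e_p(ζ)`. -/
theorem fourierBorel_jetFunctional {d : ℕ} {S : Set (CSpace d)} {p : CSpace d} (hp : p ∈ S)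
    (α : Fin d → ℕ) :
    fourierBorel S (jetFunctional hp α) = fun ζ => (∏ i, ζ i ^ α i) * expFun p ζ := by
  funext ζ
  change starRingEnd ℂ (pdList (coordList α) (expFun ζ) p) = _
  rw [pdList_expFun, coordList_prod]
  simp only [Pi.smul_apply, smul_eq_mul, map_mul, map_prod, map_pow, Complex.conj_conj, expFun]
  rw [← Complex.exp_conj, inner_conj_symm]

theorem linearIndependent_shifted {d n : ℕ} (p q : CSpace d) (a : MultiIdx d n → ℂ)
    (ha : ∀ α, a α ≠ 0) :
    LinearIndependent ℂ (fun (α : MultiIdx d n) (ζ : CSpace d) =>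
      a α * (∏ i, (ζ i - q i) ^ α.1 i) * expFun p ζ) := by
  rw [Fintype.linearIndependent_iff]
  intro g hg α
  let P : MvPolynomial (Fin d) ℂ :=
    ∑ β : MultiIdx d n, MvPolynomial.monomial (Finsupp.equivFunOnFinite.symm β.1) (g β * a β)
  have hP : P = 0 := by
    refine MvPolynomial.funext fun w => ?_
    have h1 := congrFun hg (WithLp.toLp 2 fun i => w i + q i)
    simp only [Finset.sum_apply, Pi.smul_apply, smul_eq_mul, add_sub_cancel_right,
      Pi.zero_apply] at h1
    have h2 : (∑ β : MultiIdx d n, g β * a β * ∏ i, w i ^ β.1 i) *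
        expFun p (WithLp.toLp 2 fun i => w i + q i) = 0 := by
      rw [← h1, Finset.sum_mul]
      exact Finset.sum_congr rfl fun β _ => by ring
    have h3 := (mul_eq_zero.1 h2).resolve_right (Complex.exp_ne_zero _)
    simp only [P, map_sum, MvPolynomial.eval_monomial, map_zero]
    rw [← h3]
    refine Finset.sum_congr rfl fun β _ => ?_
    rw [Finsupp.prod_fintype _ _ (by simp)]
    rfl
  have hc := congrArg (MvPolynomial.coeff (Finsupp.equivFunOnFinite.symm α.1)) hP
  simp only [P, MvPolynomial.coeff_sum, MvPolynomial.coeff_monomial, MvPolynomial.coeff_zero,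
    EmbeddingLike.apply_eq_iff_eq] at hc
  rw [Finset.sum_eq_single α (fun β _ hβ => if_neg fun h => hβ (Subtype.ext h)) (by simp)] at hc
  simp only [if_true] at hc
  exact (mul_eq_zero.1 hc).resolve_right (ha α)

theorem jetSpaceFB_eq_span {d : ℕ} {S : Set (CSpace d)} {p : CSpace d} (hp : p ∈ S) (n : ℕ) :
    jetSpaceFB hp n = Submodule.span ℂ (Set.range fun (α : MultiIdx d n) (ζ : CSpace d) =>
      (∏ i, ζ i ^ α.1 i) * expFun p ζ) := by
  rw [jetSpaceFB, jetSpace, Submodule.map_span, ← Set.range_comp]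
  congr 2
  funext α
  exact fourierBorel_jetFunctional hp α.1

theorem linearIndependent_monomials {d : ℕ} (p : CSpace d) (n : ℕ) :
    LinearIndependent ℂ (fun (α : MultiIdx d n) (ζ : CSpace d) =>
      (∏ i, ζ i ^ α.1 i) * expFun p ζ) := by
  simpa using linearIndependent_shifted (n := n) p 0 (fun _ => 1) (fun _ => one_ne_zero)

theorem fockBasisFun_mem {d : ℕ} {S : Set (CSpace d)} {p : CSpace d} (hp : p ∈ S) {n : ℕ}
    (α : MultiIdx d n) : fockBasisFun p α.1 ∈ jetSpaceFB hp n := by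
  rw [jetSpaceFB_eq_span]
  let P : MvPolynomial (Fin d) ℂ := ∏ i, (MvPolynomial.X i - MvPolynomial.C (p i)) ^ α.1 i
  have hdeg : P.totalDegree ≤ n := by
    refine (MvPolynomial.totalDegree_finsetProd _ _).trans (le_trans ?_ α.2)
    refine Finset.sum_le_sum fun i _ => (MvPolynomial.totalDegree_pow _ _).trans ?_
    refine (Nat.mul_le_mul_left _ ((MvPolynomial.totalDegree_sub_C_le _ _).trans
      (MvPolynomial.totalDegree_X i).le)).trans (by simp)
  have hP : fockBasisFun p α.1 = ∑ s ∈ P.support,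
      (((Real.exp (-‖p‖ ^ 2 / 2) / Real.sqrt (∏ i, (α.1 i).factorial : ℕ) : ℝ) : ℂ) * P.coeff s) •
        fun ζ : CSpace d => (∏ i, ζ i ^ s i) * expFun p ζ := by
    funext ζ
    have : (∏ i, (ζ i - p i) ^ α.1 i) = MvPolynomial.eval (fun i => ζ i) P := by simp [P]
    rw [fockBasisFun, this, MvPolynomial.eval_eq']
    simp only [Finset.sum_apply, Pi.smul_apply, smul_eq_mul, Finset.mul_sum, Finset.sum_mul]
    exact Finset.sum_congr rfl fun s _ => by ring
  rw [hP]
  refine Submodule.sum_mem _ fun s hs => Submodule.smul_mem _ _ (Submodule.subset_span ?_)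
  refine ⟨⟨fun i => s i, ?_⟩, rfl⟩
  have := (MvPolynomial.le_totalDegree hs).trans hdeg
  rwa [Finsupp.sum_fintype _ _ (by simp)] at this

/-- The functions `u_{p,α}`, `|α| ≤ n`, as a basis of the transform of `𝔇_{p,n}`. -/
def fockBasis {d : ℕ} {S : Set (CSpace d)} {p : CSpace d} (hp : p ∈ S) (n : ℕ) :
    Module.Basis (MultiIdx d n) ℂ (jetSpaceFB hp n) :=
  basisOfLinearIndependentOfCardEqFinrank
    (b := fun α => (⟨fockBasisFun p α.1, fockBasisFun_mem hp α⟩ : jetSpaceFB hp n))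
    (by
      refine LinearIndependent.of_comp (jetSpaceFB hp n).subtype ?_
      refine linearIndependent_shifted p p (fun α : MultiIdx d n => ((Real.exp (-‖p‖ ^ 2 / 2) /
        Real.sqrt (∏ i, (α.1 i).factorial : ℕ) : ℝ) : ℂ)) fun α => ?_
      have : 0 < Real.sqrt (∏ i, (α.1 i).factorial : ℕ) :=
        Real.sqrt_pos.2 (Nat.cast_pos.2 (Finset.prod_pos fun i _ => Nat.factorial_pos _))
      exact Complex.ofReal_ne_zero.2 (by positivity))
    (by rw [jetSpaceFB_eq_span, finrank_span_eq_card (linearIndependent_monomials p n)])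

theorem fockBasis_apply {d : ℕ} {S : Set (CSpace d)} {p : CSpace d} (hp : p ∈ S) (n : ℕ)
    (α : MultiIdx d n) : (fockBasis hp n α : CSpace d → ℂ) = fockBasisFun p α.1 := by
  simp [fockBasis]

/-- The Fourier--Borel transform restricts to an (antilinear) bijection from `𝔇_{p,n}` onto its image. -/
def fourierBorelEquiv {d : ℕ} {S : Set (CSpace d)} {p : CSpace d} (hp : p ∈ S) (n : ℕ) :
    jetSpace hp n ≃ₛₗ[starRingEnd ℂ] jetSpaceFB hp n :=
  LinearEquiv.ofBijective ((fourierBorel S).submoduleMap (jetSpace hp n)) ⟨by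
    rw [injective_iff_map_eq_zero]
    rintro ⟨φ, hφ⟩ h0
    obtain ⟨c, rfl⟩ := (Submodule.mem_span_range_iff_exists_fun ℂ).1 hφ
    have h1 : fourierBorel S (∑ α : MultiIdx d n, c α • jetFunctional hp α.1) = 0 :=
      congrArg Subtype.val h0
    simp only [map_sum, LinearMap.map_smulₛₗ, fourierBorel_jetFunctional] at h1
    have h2 := Fintype.linearIndependent_iff.1 (linearIndependent_monomials p n)
      (fun α => starRingEnd ℂ (c α)) h1
    refine Subtype.ext ?_
    refine Finset.sum_eq_zero fun α _ => ?_
    have : c α = 0 := by simpa using h2 α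
    rw [this, zero_smul], LinearMap.submoduleMap_surjective _ _⟩

/-! ### The push-forward preserves jets -/

theorem pd_comm {d : ℕ} (i j : Fin d) {h : CSpace d → ℂ} {z : CSpace d} (hh : AnalyticAt ℂ h z) :
    pd i (pd j h) z = pd j (pd i h) z := by
  have hd : DifferentiableAt ℂ (fderiv ℂ h) z := hh.fderiv.differentiableAt
  have key : ∀ a b : Fin d, pd a (pd b h) z =
      fderiv ℂ (fderiv ℂ h) z (EuclideanSpace.single a 1) (EuclideanSpace.single b 1) := by
    intro a b
    change fderiv ℂ (fun w => fderiv ℂ h w (EuclideanSpace.single b 1)) z _ = _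
    rw [fderiv_clm_apply hd (differentiableAt_const _)]
    simp
  rw [key, key]
  have hs : IsSymmSndFDerivAt ℂ h z := (hh.contDiffAt (n := ⊤)).isSymmSndFDerivAt (by simp)
  exact hs _ _

theorem pdList_perm {d : ℕ} {l l' : List (Fin d)} (hl : l.Perm l') {h : CSpace d → ℂ}
    (hh : AnalyticOnNhd ℂ h Set.univ) : pdList l h = pdList l' h := by
  induction hl with
  | nil => rfl
  | cons a _ ih => exact congrArg (pd a) ih
  | swap a b l =>
    funext z
    exact pd_comm b a (pdList_analyticAt l (hh z (Set.mem_univ _)))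
  | trans _ _ ih1 ih2 => exact ih1.trans ih2

theorem vec_eq_sum {r : ℕ} (w : CSpace r) : w = ∑ j, w j • EuclideanSpace.single j (1 : ℂ) := by
  ext k
  simp [Pi.single_apply]

/-- Derivatives of `h ∘ f` of order at most `n` are combinations of derivatives of `h` of order at most `n`. -/
theorem pdList_comp {d r : ℕ} (f : CSpace d → CSpace r) (l : List (Fin d)) :
    ∃ (ι : Type) (_ : Fintype ι) (β : ι → List (Fin r)) (c : ι → CSpace d → ℂ),
      (∀ k, (β k).length ≤ l.length) ∧ (∀ k z, AnalyticAt ℂ f z → AnalyticAt ℂ (c k) z) ∧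
      ∀ h : CSpace r → ℂ, AnalyticOnNhd ℂ h Set.univ → ∀ z, AnalyticAt ℂ f z →
        pdList l (h ∘ f) z = ∑ k, c k z * pdList (β k) h (f z) := by
  induction l with
  | nil =>
    refine ⟨Unit, inferInstance, fun _ => [], fun _ _ => 1, by simp,
      fun _ _ _ => analyticAt_const, ?_⟩
    intro h _ z _
    simp [pdList]
  | cons i l ih =>
    obtain ⟨ι, _, β, c, hlen, hc, H⟩ := ih
    refine ⟨ι ⊕ (ι × Fin r), inferInstance, Sum.elim β (fun kj => kj.2 :: β kj.1),
      Sum.elim (fun k => pd i (c k))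
        (fun kj z => c kj.1 z * (fderiv ℂ f z (EuclideanSpace.single i 1)) kj.2), ?_, ?_, ?_⟩
    · rintro (k | ⟨k, j⟩)
      · exact (hlen k).trans (by simp)
      · simpa using hlen k
    · rintro (k | ⟨k, j⟩) z hz
      · exact pd_analyticAt i (hc k z hz)
      · refine (hc k z hz).mul ?_
        have h1 : AnalyticAt ℂ (fun w => fderiv ℂ f w (EuclideanSpace.single i 1)) z :=
          ((ContinuousLinearMap.apply ℂ (CSpace r)
            (EuclideanSpace.single i (1 : ℂ))).analyticAt _).comp hz.fderiv
        exact ((EuclideanSpace.proj (𝕜 := ℂ) j : CSpace r →L[ℂ] ℂ).analyticAt _).comp h1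
    · intro h hh z hz
      have e1 : pdList l (h ∘ f) =ᶠ[𝓝 z] fun w => ∑ k, c k w * pdList (β k) h (f w) := by
        filter_upwards [hz.eventually_analyticAt] with w hw using H h hh w hw
      have hg : ∀ k, DifferentiableAt ℂ (pdList (β k) h) (f z) := fun k =>
        (pdList_analyticAt (β k) (hh _ (Set.mem_univ _))).differentiableAt
      have hfd : ∀ k, HasFDerivAt (fun w => c k w * pdList (β k) h (f w))
          (c k z • (fderiv ℂ (pdList (β k) h) (f z)).comp (fderiv ℂ f z) +
            pdList (β k) h (f z) • fderiv ℂ (c k) z) z := fun k =>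
        (hc k z hz).differentiableAt.hasFDerivAt.mul
          ((hg k).hasFDerivAt.comp z hz.differentiableAt.hasFDerivAt)
      have e2 : pdList (i :: l) (h ∘ f) z = pd i (fun w => ∑ k, c k w * pdList (β k) h (f w)) z :=
        (pd_congr i e1).eq_of_nhds
      rw [e2, pd, (HasFDerivAt.fun_sum fun k _ => hfd k).fderiv, Fintype.sum_sum_type,
        Fintype.sum_prod_type]
      simp only [Sum.elim_inl, Sum.elim_inr, sum_apply,
        add_apply, smul_apply,
        ContinuousLinearMap.comp_apply, smul_eq_mul]
      rw [← Finset.sum_add_distrib]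
      refine Finset.sum_congr rfl fun k _ => ?_
      have e3 : fderiv ℂ (pdList (β k) h) (f z) (fderiv ℂ f z (EuclideanSpace.single i 1)) =
          ∑ j, (fderiv ℂ f z (EuclideanSpace.single i 1)) j * pdList (j :: β k) h (f z) := by
        conv_lhs => rw [vec_eq_sum (fderiv ℂ f z (EuclideanSpace.single i 1))]
        rw [map_sum]
        exact Finset.sum_congr rfl fun j _ => by rw [map_smul]; rfl
      rw [e3, Finset.mul_sum, add_comm]
      congr 1
      · rw [pd, mul_comm]
      · exact Finset.sum_congr rfl fun j _ => by ring

theorem pushforward_mem_jetSpace {d r : ℕ} {S : Set (CSpace d)} {p : CSpace d} (hp : p ∈ S)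
    (f : CSpace d → CSpace r) (hf : AnalyticOnNhd ℂ f S) (n : ℕ) :
    ∀ φ ∈ jetSpace hp n, pushforward f hf φ ∈ jetSpace (Set.mem_univ (f p)) n := by
  intro φ hφ
  induction hφ using Submodule.span_induction with
  | zero => rw [map_zero]; exact Submodule.zero_mem _
  | add x y _ _ hx hy => rw [map_add]; exact Submodule.add_mem _ hx hy
  | smul a x _ hx => rw [map_smul]; exact Submodule.smul_mem _ _ hx
  | mem x hx =>
    obtain ⟨α, rfl⟩ := hx
    obtain ⟨ι, _, β, c, hlen, -, H⟩ := pdList_comp f (coordList α.1)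
    have e : pushforward f hf (jetFunctional hp α.1) =
        ∑ k, c k p • jetFunctional (Set.mem_univ (f p)) (fun j => (β k).count j) := by
      refine Subtype.ext (LinearMap.ext fun g => ?_)
      obtain ⟨h, hh, rfl⟩ := HolGerm.exists_rep g
      have e1 : (pushforward f hf (jetFunctional hp α.1)).1 (HolGerm.mk h hh) =
          pdList (coordList α.1) (h ∘ f) p := rfl
      rw [e1, H h hh p (hf p hp)]
      simp only [AddSubmonoidClass.coe_finsetSum, LinearMap.sum_apply]
      refine Finset.sum_congr rfl fun k _ => ?_
      have e2 : ((c k p • jetFunctional (Set.mem_univ (f p)) (fun j => (β k).count j) :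
          AnalyticFunctional Set.univ) : HolGerm Set.univ →ₗ[ℂ] ℂ) (HolGerm.mk h hh) =
          c k p * pdList (coordList fun j => (β k).count j) h (f p) := rfl
      rw [e2, pdList_perm (list_perm_coordList (β k)) hh]
    change pushforward f hf (jetFunctional hp α.1) ∈ _
    rw [e]
    refine Submodule.sum_mem _ fun k _ => Submodule.smul_mem _ _ (Submodule.subset_span ?_)
    refine ⟨⟨fun j => (β k).count j, ?_⟩, rfl⟩
    rw [list_sum_count]
    exact (hlen k).trans ((coordList_length α.1).le.trans α.2)

/-- The transported push-forward `FB ∘ f_* ∘ FB⁻¹` between the transforms of `𝔇_{p,m}` and `𝔇_{f(p),m}`. -/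
def pushforwardFB {d r : ℕ} {S : Set (CSpace d)} {p : CSpace d} (hp : p ∈ S)
    (f : CSpace d → CSpace r) (hf : AnalyticOnNhd ℂ f S) (m : ℕ) :
    jetSpaceFB hp m →ₗ[ℂ] jetSpaceFB (Set.mem_univ (f p)) m :=
  (fourierBorelEquiv (Set.mem_univ (f p)) m).toLinearMap.comp
    (((pushforward f hf).restrict (pushforward_mem_jetSpace hp f hf m)).comp
      (fourierBorelEquiv hp m).symm.toLinearMap)

/-- `C_m`: the matrix of `FB ∘ f_* ∘ FB⁻¹` in the bases `(u_{p,α})_{|α| ≤ m}` and `(v_{f(p),β})_{|β| ≤ m}`. -/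
def pushforwardMatrix {d r : ℕ} {S : Set (CSpace d)} {p : CSpace d} (hp : p ∈ S)
    (f : CSpace d → CSpace r) (hf : AnalyticOnNhd ℂ f S) (m : ℕ) :
    Matrix (MultiIdx r m) (MultiIdx d m) ℂ :=
  LinearMap.toMatrix (fockBasis hp m) (fockBasis (Set.mem_univ (f p)) m) (pushforwardFB hp f hf m)

/-! ### Data matrices -/

/-- The four Penrose equations characterizing the Moore--Penrose pseudo-inverse `B` of `A`. -/
def IsMoorePenrose {m n : Type*} [Fintype m] [Fintype n] (A : Matrix m n ℂ) (B : Matrix n m ℂ) :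
    Prop :=
  A * B * A = A ∧ B * A * B = B ∧ (A * B).conjTranspose = A * B ∧ (B * A).conjTranspose = B * A

theorem IsMoorePenrose.unique {m n : Type*} [Fintype m] [Fintype n] {A : Matrix m n ℂ}
    {B B' : Matrix n m ℂ} (h : IsMoorePenrose A B) (h' : IsMoorePenrose A B') : B = B' := by
  obtain ⟨h1, h2, h3, h4⟩ := h
  obtain ⟨k1, k2, k3, k4⟩ := h'
  have e1 : A * B = A * B' := by
    calc A * B = (A * B' * A) * B := by rw [k1]
      _ = (A * B') * (A * B) := by simp only [Matrix.mul_assoc]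
      _ = (A * B').conjTranspose * (A * B).conjTranspose := by rw [h3, k3]
      _ = ((A * B * A) * B').conjTranspose := by
        rw [← Matrix.conjTranspose_mul]; simp only [Matrix.mul_assoc]
      _ = A * B' := by rw [h1, k3]
  have e2 : B * A = B' * A := by
    calc B * A = B * (A * B' * A) := by rw [k1]
      _ = (B * A) * (B' * A) := by simp only [Matrix.mul_assoc]
      _ = (B * A).conjTranspose * (B' * A).conjTranspose := by rw [h4, k4]
      _ = (B' * (A * B * A)).conjTranspose := by
        rw [← Matrix.conjTranspose_mul]; simp only [Matrix.mul_assoc]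
      _ = B' * A := by rw [h1, k4]
  calc B = B * A * B := h2.symm
    _ = B' * (A * B) := by rw [e2, Matrix.mul_assoc]
    _ = B' * A * B' := by rw [e1, Matrix.mul_assoc]
    _ = B' := k2

open scoped ComplexOrder in
theorem exists_isMoorePenrose {m n : Type*} [Fintype m] [Fintype n] (A : Matrix m n ℂ) :
    ∃ B : Matrix n m ℂ, IsMoorePenrose A B := by
  classical
  have hH : (A.conjTranspose * A).IsHermitian := Matrix.isHermitian_conjTranspose_mul_self A
  set H := A.conjTranspose * A with hHdef
  set V : Matrix n n ℂ := (hH.eigenvectorUnitary : Matrix n n ℂ) with hV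
  set D : Matrix n n ℂ := Matrix.diagonal (RCLike.ofReal ∘ hH.eigenvalues) with hD
  set D' : Matrix n n ℂ := Matrix.diagonal (fun i => ((hH.eigenvalues i : ℝ) : ℂ)⁻¹) with hD'
  have hVV : V.conjTranspose * V = 1 := Unitary.coe_star_mul_self hH.eigenvectorUnitary
  have hspec : H = V * D * V.conjTranspose := by
    have := hH.spectral_theorem
    rwa [Unitary.conjStarAlgAut_apply] at this
  have hDD : D * D' * D = D := by
    rw [hD, hD', Matrix.diagonal_mul_diagonal, Matrix.diagonal_mul_diagonal]
    congr 1
    funext i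
    exact mul_inv_mul_cancel ((hH.eigenvalues i : ℝ) : ℂ)
  have hDD2 : D' * D * D' = D' := by
    rw [hD, hD', Matrix.diagonal_mul_diagonal, Matrix.diagonal_mul_diagonal]
    congr 1
    funext i
    have := mul_inv_mul_cancel ((hH.eigenvalues i : ℝ) : ℂ)⁻¹
    rwa [inv_inv] at this
  have hcomm : D' * D = D * D' := by
    rw [hD, hD', Matrix.diagonal_mul_diagonal, Matrix.diagonal_mul_diagonal]
    congr 1
    funext i
    exact mul_comm _ _
  have hDs : D.conjTranspose = D := by
    rw [hD, Matrix.diagonal_conjTranspose]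
    congr 1
    funext i
    simp
  have hDs' : D'.conjTranspose = D' := by
    rw [hD', Matrix.diagonal_conjTranspose]
    congr 1
    funext i
    simp
  set G := V * D' * V.conjTranspose with hG
  have mid : ∀ X Y : Matrix n n ℂ,
      (V * X * V.conjTranspose) * (V * Y * V.conjTranspose) = V * (X * Y) * V.conjTranspose := by
    intro X Y
    calc _ = V * X * (V.conjTranspose * V) * Y * V.conjTranspose := by simp only [Matrix.mul_assoc]
      _ = _ := by rw [hVV]; simp only [Matrix.mul_assoc, Matrix.mul_one]
  have g1 : H * G * H = H := by
    rw [hspec, hG, mid, mid, hDD]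
  have g2 : G * H * G = G := by
    rw [hspec, hG, mid, mid, hDD2]
  have gs : G.conjTranspose = G := by
    rw [hG]; simp [Matrix.conjTranspose_mul, hDs', Matrix.mul_assoc]
  have g3 : (G * H).conjTranspose = G * H := by
    rw [hspec, hG, mid]; simp [Matrix.conjTranspose_mul, hDs', hDs, Matrix.mul_assoc, hcomm]
  have hs : H.conjTranspose = H := hH
  have key : A * (G * H) = A := by
    have h0 : (A * (1 - G * H)).conjTranspose * (A * (1 - G * H)) = 0 := by
      calc _ = (1 - G * H).conjTranspose * (H - H * G * H) := by
            rw [Matrix.conjTranspose_mul, hHdef]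
            simp only [Matrix.mul_assoc, Matrix.mul_sub, Matrix.mul_one]
        _ = 0 := by rw [g1]; simp
    have h1 := Matrix.conjTranspose_mul_self_eq_zero.1 h0
    rw [Matrix.mul_sub, Matrix.mul_one, sub_eq_zero] at h1
    exact h1.symm
  refine ⟨G * A.conjTranspose, ?_, ?_, ?_, ?_⟩
  · calc _ = A * (G * (A.conjTranspose * A)) := by simp only [Matrix.mul_assoc]
      _ = A := key
  · calc _ = G * (A.conjTranspose * A) * G * A.conjTranspose := by simp only [Matrix.mul_assoc]
      _ = _ := by rw [← hHdef, g2]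
  · simp [Matrix.conjTranspose_mul, gs, Matrix.mul_assoc]
  · rw [Matrix.mul_assoc, ← hHdef, g3]

/-- The Moore--Penrose pseudo-inverse `A†`. -/
def pseudoInverse {m n : Type*} [Fintype m] [Fintype n] (A : Matrix m n ℂ) : Matrix n m ℂ :=
  Classical.choose (exists_isMoorePenrose A)

theorem pseudoInverse_spec {m n : Type*} [Fintype m] [Fintype n] (A : Matrix m n ℂ) :
    IsMoorePenrose A (pseudoInverse A) :=
  Classical.choose_spec (exists_isMoorePenrose A)

/-- The Frobenius norm `(tr (A^* A))^{1/2}`. -/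
def frobeniusNorm {m n : Type*} [Fintype m] [Fintype n] (A : Matrix m n ℂ) : ℝ :=
  Real.sqrt (A.conjTranspose * A).trace.re

/-- The matrix whose `k`-th row is `(u_{p,α}(z^k))_{|α| ≤ n}`. -/
def dataMatrix {d N : ℕ} (p : CSpace d) (n : ℕ) (z : Fin N → CSpace d) :
    Matrix (Fin N) (MultiIdx d n) ℂ :=
  Matrix.of fun k α => fockBasisFun p α.1 (z k)

/-- `Ĉ_{m,n,Z}`: the columns `|α| ≤ m` of `V_{f(p),m,W}^* (U_{p,n,Z}^*)†`, where `w^k = f(z^k)`. -/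
def empiricalMatrix {d r N : ℕ} (p : CSpace d) (f : CSpace d → CSpace r) {m n : ℕ} (hmn : m ≤ n)
    (z : Fin N → CSpace d) : Matrix (MultiIdx r m) (MultiIdx d m) ℂ :=
  ((dataMatrix (f p) m fun k => f (z k)).conjTranspose *
    pseudoInverse (dataMatrix p n z).conjTranspose).submatrix id (MultiIdx.castLE hmn)

/-! ### Quantities attached to the sampling measure -/

/-- The moment matrix `D_n(μ)` with entries `∫ conj(x^α) x^β dμ(x)`. -/
def momentMatrix {d : ℕ} (n : ℕ) (μ : Measure (CSpace d)) :
    Matrix (MultiIdx d n) (MultiIdx d n) ℂ :=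
  Matrix.of fun α β => ∫ x, starRingEnd ℂ (∏ i, x i ^ α.1 i) * ∏ i, x i ^ β.1 i ∂μ

theorem momentMatrix_isHermitian {d : ℕ} (n : ℕ) (μ : Measure (CSpace d)) :
    (momentMatrix n μ).IsHermitian := by
  ext α β
  simp only [momentMatrix, Matrix.conjTranspose_apply, Matrix.of_apply, RCLike.star_def]
  rw [← integral_conj]
  congr 1
  funext x
  rw [map_mul, Complex.conj_conj, mul_comm]

/-- For a measure carried by `ℝ^d` the entries are the moments `∫ x^{α+β} dμ(x)`. -/
theorem momentMatrix_apply_of_real {d : ℕ} (n : ℕ) (μ : Measure (CSpace d))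
    (hμ : ∀ᵐ x ∂μ, ∀ i, (x i).im = 0) (α β : MultiIdx d n) :
    momentMatrix n μ α β = ∫ x, ∏ i, x i ^ (α.1 i + β.1 i) ∂μ := by
  refine integral_congr_ae ?_
  filter_upwards [hμ] with x hx
  have : ∀ i, starRingEnd ℂ (x i) = x i := fun i => Complex.conj_eq_iff_im.2 (hx i)
  simp [map_prod, this, pow_add, Finset.prod_mul_distrib]

/-- `Λ_n(μ)`, the smallest eigenvalue of `D_n(μ)`. -/
def minEigenvalue {d : ℕ} (n : ℕ) (μ : Measure (CSpace d)) : ℝ :=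
  ⨅ α, (momentMatrix_isHermitian n μ).eigenvalues α

/-- `K` is absolutely convex: `a x + b y ∈ K` for `x, y ∈ K` and `|a| + |b| ≤ 1`. -/
def IsAbsConvex {d : ℕ} (K : Set (CSpace d)) : Prop :=
  ∀ x ∈ K, ∀ y ∈ K, ∀ a b : ℂ, ‖a‖ + ‖b‖ ≤ 1 → a • x + b • y ∈ K

/-- `R_μ = sup_{x ∈ supp μ} |x|_{K₀}`, where `|x|_{K₀} = inf {t > 0 : x ∈ t K₀}`. -/
def gaugeRadius {d : ℕ} (K₀ : Set (CSpace d)) (μ : Measure (CSpace d)) : ℝ :=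
  sSup (gauge K₀ '' μ.support)

/-- `L_μ = max (1, sup_{z ∈ supp μ} max_i |z_i|)`. -/
def coordBound {d : ℕ} (μ : Measure (CSpace d)) : ℝ :=
  max 1 (sSup {t : ℝ | ∃ z ∈ μ.support, ∃ i, t = ‖z i‖})

theorem mem_translate {d : ℕ} (p : CSpace d) {K₀ : Set (CSpace d)} (hK₀ : K₀ ∈ 𝓝 0) :
    p ∈ p +ᵥ K₀ :=
  ⟨0, mem_of_mem_nhds hK₀, by simp⟩

end FockPushforward

end

open FockPushforward

noncomputable section

namespace FockPushforward

/-! ### Constant coefficient differential operators and Taylor expansion -/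

/-! The function `u_{p,α}` is the transform of the jet functional `fockCoeff p α`, which takes a
normalised Taylor coefficient at `p` of `e_{-p} h`. These functionals are dual to the functions
`v_{q,β}` at `q = f(p)`. Hence the entries of `C_m` are, up to conjugation, the coefficients
`a_{αβ}` of `v_{q,β} ∘ f` in the system `u_{p,α}` (`conj_pushforwardMatrix`), and the empirical
matrix is the least squares estimate of these coefficients from the sample.

On the sample, `V = U a + ρ`, where `ρ` is `e_p` times the remainder of the Taylor expansion of
`e_{-p} (v_{q,β} ∘ f)` at order `n`. If `U` is injective, then `T`, the adjoint of the
pseudo-inverse of `U^*`, is a left inverse of `U`, so `T V = a + T ρ` and the error consists of the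
rows `|α| ≤ m` of `T ρ`. Since `U T` is an orthogonal projection, `‖U T ρ‖ ≤ ‖ρ‖`, and a lower bound
for `U` finishes the deterministic part (`frobeniusNorm_sub_sq_le`).

The two sides are estimated separately. Restricting to complex lines through `p`, Cauchy's estimate
bounds the remainder by a multiple of `R_μ^(n+1)`. The multiple does not depend on `m`, because `∑_β
|v_{q,β}|²` is dominated by an exponential series. For the lower bound, `U` is the matrix of
monomials at the sample points, multiplied on the left by the values of `e_p` and on the right by
the weights of `u_{p,α}`. The weights with `|α| ≤ m` cost at most a factor `m!` in the square.

The Gram matrix of the monomials is `N` times the empirical moment matrix, an average of i.i.d. rank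
one matrices with mean `D_n(μ)`. A Pinelis type bound in the Hilbert space of matrices shows that,
outside an event of probability at most `δ`, its Frobenius distance to `D_n(μ)` is less than `7Λ/8`.
This leaves the bound `Λ/8` from below, whence the factor `√8 = 2√2` in the final estimate. -/

theorem pdList_perm_eventuallyEq {d : ℕ} {l l' : List (Fin d)} (hl : l.Perm l')
    {h : CSpace d → ℂ} {z : CSpace d} (hh : AnalyticAt ℂ h z) :
    pdList l h =ᶠ[𝓝 z] pdList l' h := by
  induction hl with
  | nil => exact EventuallyEq.rfl
  | cons a _ ih => exact pd_congr a ih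
  | swap a b l =>
    filter_upwards [hh.eventually_analyticAt] with w hw
    exact pd_comm b a (pdList_analyticAt l hw)
  | trans _ _ ih1 ih2 => exact ih1.trans ih2

theorem multiDeriv_add_single {d : ℕ} (α : Fin d → ℕ) (i : Fin d) {h : CSpace d → ℂ}
    {z : CSpace d} (hh : AnalyticAt ℂ h z) :
    multiDeriv (α + Pi.single i 1) h z = pd i (multiDeriv α h) z := by
  refine (pdList_perm_eventuallyEq (l' := i :: coordList α) ?_ hh).eq_of_nhds
  rw [List.perm_iff_count]
  intro j
  rw [coordList_count, List.count_cons, coordList_count]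
  by_cases hij : i = j
  · subst hij; simp
  · simp [hij, Ne.symm hij]

theorem multiDeriv_zero {d : ℕ} (h : CSpace d → ℂ) : multiDeriv 0 h = h := by
  have h1 : coordList (0 : Fin d → ℕ) = [] := List.length_eq_zero_iff.1 (by simp [coordList_length])
  rw [multiDeriv, h1]
  rfl

/-- The value `(q(∂) h)(z)` of the constant coefficient differential operator with symbol `q`. -/
def symbolApply {d : ℕ} (h : CSpace d → ℂ) (z : CSpace d) : MvPolynomial (Fin d) ℂ →ₗ[ℂ] ℂ :=
  (MvPolynomial.basisMonomials (Fin d) ℂ).constr ℂ fun s => multiDeriv s h z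

theorem symbolApply_monomial {d : ℕ} (h : CSpace d → ℂ) (z : CSpace d) (s : Fin d →₀ ℕ) (a : ℂ) :
    symbolApply h z (MvPolynomial.monomial s a) = a * multiDeriv s h z := by
  have h1 : MvPolynomial.monomial s a = a • (MvPolynomial.basisMonomials (Fin d) ℂ s) := by
    simp [MvPolynomial.smul_monomial]
  rw [h1, map_smul, symbolApply, Module.Basis.constr_basis, smul_eq_mul]

theorem symbolApply_eq_sum {d : ℕ} (h : CSpace d → ℂ) (z : CSpace d)
    (q : MvPolynomial (Fin d) ℂ) :
    symbolApply h z q = ∑ s ∈ q.support, q.coeff s * multiDeriv s h z := by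
  conv_lhs => rw [q.as_sum]
  simp only [map_sum, symbolApply_monomial]

theorem symbolApply_analyticAt {d : ℕ} {h : CSpace d → ℂ} {z : CSpace d}
    (hh : AnalyticAt ℂ h z) (q : MvPolynomial (Fin d) ℂ) :
    AnalyticAt ℂ (fun w => symbolApply h w q) z := by
  simp only [symbolApply_eq_sum]
  exact Finset.analyticAt_fun_sum _ fun s _ => analyticAt_const.mul (pdList_analyticAt _ hh)

/-- Since partial derivatives commute, multiplication of symbols is composition of operators. This
moves the Leibniz rule for exponentials and the multinomial expansion into the polynomial ring. -/
theorem symbolApply_X_mul {d : ℕ} {h : CSpace d → ℂ} {z : CSpace d} (hh : AnalyticAt ℂ h z)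
    (i : Fin d) (q : MvPolynomial (Fin d) ℂ) :
    symbolApply h z (MvPolynomial.X i * q) = pd i (fun w => symbolApply h w q) z := by
  induction q using MvPolynomial.induction_on' with
  | monomial s a =>
    simp only [symbolApply_monomial]
    have h1 : (MvPolynomial.X i * MvPolynomial.monomial s a : MvPolynomial (Fin d) ℂ) =
        MvPolynomial.monomial (s + Finsupp.single i 1) a := by
      rw [mul_comm, MvPolynomial.monomial_add_single, pow_one]
    have h2 : DFunLike.coe (s + Finsupp.single i 1) = (s : Fin d → ℕ) + Pi.single i 1 := by
      rw [Finsupp.coe_add, Finsupp.single_eq_pi_single]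
    have h3 : DifferentiableAt ℂ (multiDeriv s h) z :=
      (pdList_analyticAt (coordList s) hh).differentiableAt
    rw [h1, symbolApply_monomial, h2, multiDeriv_add_single _ _ hh, pd, pd, fderiv_const_mul h3]
    rfl
  | add q q' hq hq' =>
    rw [mul_add, map_add, hq, hq']
    simp only [map_add, pd]
    rw [fderiv_fun_add (symbolApply_analyticAt hh q).differentiableAt
      (symbolApply_analyticAt hh q').differentiableAt]
    rfl

/-- Conjugating derivatives with the exponential `e_{-p}` shifts the symbol by `p^*`. -/
theorem pdList_expFun_neg_mul {d : ℕ} (p : CSpace d) (l : List (Fin d)) {h : CSpace d → ℂ}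
    {z : CSpace d} (hh : AnalyticAt ℂ h z) :
    pdList l (fun w => expFun (-p) w * h w) =ᶠ[𝓝 z] fun w => expFun (-p) w *
      symbolApply h w
        (l.map fun i => MvPolynomial.X i - MvPolynomial.C (starRingEnd ℂ (p i))).prod := by
  induction l with
  | nil =>
    refine Eventually.of_forall fun w => ?_
    have : (1 : MvPolynomial (Fin d) ℂ) = MvPolynomial.monomial 0 1 := rfl
    simp only [List.map_nil, List.prod_nil]
    rw [this, symbolApply_monomial]
    simp [pdList, multiDeriv_zero]
  | cons i l ih =>
    refine (pd_congr i ih).trans ?_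
    filter_upwards [hh.eventually_analyticAt] with w hw
    set q := (l.map fun i => MvPolynomial.X i - MvPolynomial.C (starRingEnd ℂ (p i))).prod with hq
    -- The Leibniz rule gives `∂_i (e_{-p} g) = e_{-p} (∂_i - conj (p_i)) g`, so each derivative
    -- contributes one shifted factor.
    have h1 : HasFDerivAt (fun w => expFun (-p) w * symbolApply h w q)
        (expFun (-p) w • fderiv ℂ (fun w => symbolApply h w q) w +
          symbolApply h w q • fderiv ℂ (expFun (-p)) w) w :=
      (expFun_analytic (-p) Set.univ w (Set.mem_univ _)).differentiableAt.hasFDerivAt.mul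
        (symbolApply_analyticAt hw q).differentiableAt.hasFDerivAt
    have h2 := congrFun (pd_expFun i (-p)) w
    rw [pd] at h2
    have h3 := symbolApply_X_mul hw i q
    rw [pd] at h3
    rw [pd, h1.fderiv]
    simp only [add_apply, smul_apply, smul_eq_mul, h2, ← h3, List.map_cons, List.prod_cons, ← hq,
      sub_mul, map_sub, MvPolynomial.C_mul', map_smul, Pi.smul_apply, PiLp.neg_apply, map_neg]
    ring

theorem multiDeriv_expFun_neg_mul {d : ℕ} (p : CSpace d) (α : Fin d → ℕ) {h : CSpace d → ℂ}
    {z : CSpace d} (hh : AnalyticAt ℂ h z) :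
    multiDeriv α (fun w => expFun (-p) w * h w) z = expFun (-p) z * symbolApply h z
      (∏ i, (MvPolynomial.X i - MvPolynomial.C (starRingEnd ℂ (p i))) ^ α i) := by
  rw [multiDeriv, (pdList_expFun_neg_mul p (coordList α) hh).eq_of_nhds]
  congr 2
  rw [coordList, List.map_flatMap, List.flatMap, List.prod_flatten, List.map_map,
    ← List.prod_ofFn, List.ofFn_eq_map]
  congr 1
  refine List.map_congr_left fun i _ => ?_
  simp

theorem hasDerivAt_symbolApply_line {d : ℕ} {h : CSpace d → ℂ} (p x : CSpace d) {t : ℂ}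
    (hh : AnalyticAt ℂ h (p + t • x)) (q : MvPolynomial (Fin d) ℂ) :
    HasDerivAt (fun t : ℂ => symbolApply h (p + t • x) q)
      (symbolApply h (p + t • x) ((∑ i, MvPolynomial.C (x i) * MvPolynomial.X i) * q)) t := by
  have h1 := (symbolApply_analyticAt hh q).differentiableAt.hasFDerivAt
  have h2 : HasDerivAt (fun t : ℂ => p + t • x) x t := by
    simpa using ((hasDerivAt_id t).smul_const x).const_add p
  refine (h1.comp_hasDerivAt t h2).congr_deriv ?_
  have h3 := congrArg (fderiv ℂ (fun w => symbolApply h w q) (p + t • x)) (vec_eq_sum x)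
  rw [h3, map_sum, Finset.sum_mul, map_sum]
  refine Finset.sum_congr rfl fun i _ => ?_
  rw [map_smul, mul_assoc, MvPolynomial.C_mul', map_smul, symbolApply_X_mul hh, pd]

/-- Differentiating along the line in direction `x` is the operator with symbol `∑ x_i X_i`, and
iteration takes its powers. The identity is proved at all nearby `t` so that it can be
differentiated again. -/
theorem iteratedDeriv_line {d : ℕ} {h : CSpace d → ℂ} (p x : CSpace d) (k : ℕ) {t : ℂ}
    (hh : AnalyticAt ℂ h (p + t • x)) :
    iteratedDeriv k (fun t : ℂ => h (p + t • x)) t =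
      symbolApply h (p + t • x) ((∑ i, MvPolynomial.C (x i) * MvPolynomial.X i) ^ k) := by
  induction k generalizing t with
  | zero =>
    have : (1 : MvPolynomial (Fin d) ℂ) = MvPolynomial.monomial 0 1 := rfl
    rw [iteratedDeriv_zero, pow_zero, this, symbolApply_monomial]
    simp [multiDeriv_zero]
  | succ k ih =>
    have hc : ContinuousAt (fun t : ℂ => p + t • x) t := by fun_prop
    have h1 : iteratedDeriv k (fun t : ℂ => h (p + t • x)) =ᶠ[𝓝 t] fun t =>
        symbolApply h (p + t • x) ((∑ i, MvPolynomial.C (x i) * MvPolynomial.X i) ^ k) := by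
      filter_upwards [hc.eventually hh.eventually_analyticAt] with s hs using ih hs
    rw [iteratedDeriv_succ, h1.deriv_eq, (hasDerivAt_symbolApply_line p x hh _).deriv, pow_succ']

/-- The multinomial theorem, which identifies the degree `k` coefficient along a line with the
homogeneous part of degree `k` of the Taylor polynomial. -/
theorem symbolApply_linear_pow {d : ℕ} (h : CSpace d → ℂ) (z x : CSpace d) (k : ℕ) :
    symbolApply h z ((∑ i, MvPolynomial.C (x i) * MvPolynomial.X i) ^ k) =
      ∑ α ∈ Finset.univ.piAntidiag k,
        (k.factorial : ℂ) * ((∏ i, x i ^ α i) / (∏ i, (α i).factorial : ℕ) * multiDeriv α h z) := by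
  rw [Finset.sum_pow_eq_sum_piAntidiag, map_sum]
  refine Finset.sum_congr rfl fun α hα => ?_
  rw [Finset.mem_piAntidiag] at hα
  have h1 : ((Nat.multinomial Finset.univ α : ℕ) : MvPolynomial (Fin d) ℂ) *
      ∏ i, (MvPolynomial.C (x i) * MvPolynomial.X i) ^ α i =
      MvPolynomial.monomial (Finsupp.equivFunOnFinite.symm α)
        ((Nat.multinomial Finset.univ α : ℂ) * ∏ i, x i ^ α i) := by
    rw [MvPolynomial.monomial_eq, Finsupp.prod_fintype _ _ (by simp)]
    simp only [mul_pow, Finset.prod_mul_distrib, map_mul, map_prod, map_pow, map_natCast]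
    rw [mul_assoc]
    rfl
  have h2 : (∏ i, ((α i).factorial : ℂ)) * (Nat.multinomial Finset.univ α : ℂ) =
      (k.factorial : ℂ) := by
    rw [← hα.1]
    exact_mod_cast Nat.multinomial_spec Finset.univ α
  have h3 : (∏ i, ((α i).factorial : ℂ)) ≠ 0 :=
    Finset.prod_ne_zero_iff.2 fun i _ => Nat.cast_ne_zero.2 (Nat.factorial_ne_zero _)
  rw [h1, symbolApply_monomial, ← h2]
  push_cast
  field_simp
  rfl

/-- The Taylor polynomial of degree `n` at `p`. -/
def taylorPoly {d : ℕ} (n : ℕ) (h : CSpace d → ℂ) (p x : CSpace d) : ℂ :=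
  ∑ α : MultiIdx d n, (∏ i, x i ^ α.1 i) / (∏ i, (α.1 i).factorial : ℕ) * multiDeriv α.1 h p

theorem sum_multiIdx {d n : ℕ} (F : (Fin d → ℕ) → ℂ) :
    ∑ α : MultiIdx d n, F α.1 =
      ∑ k ∈ Finset.range (n + 1), ∑ α ∈ Finset.univ.piAntidiag k, F α := by
  rw [← Finset.sum_fiberwise_of_maps_to (s := Finset.univ) (t := Finset.range (n + 1))
    (g := fun α : MultiIdx d n => ∑ i, α.1 i)
    (fun α _ => Finset.mem_range.2 (Nat.lt_succ_of_le α.2))]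
  refine Finset.sum_congr rfl fun k hk => ?_
  refine Finset.sum_bij (fun α _ => α.1) ?_ ?_ ?_ (fun _ _ => rfl)
  · intro α hα
    rw [Finset.mem_filter] at hα
    simp [Finset.mem_piAntidiag, hα.2]
  · intro α _ β _ hab
    exact Subtype.ext hab
  · intro α hα
    rw [Finset.mem_piAntidiag] at hα
    refine ⟨⟨α, hα.1.le.trans (Nat.lt_succ_iff.1 (Finset.mem_range.1 hk))⟩, ?_, rfl⟩
    exact Finset.mem_filter.2 ⟨Finset.mem_univ _, hα.1⟩

/-- Taylor's formula with the Cauchy estimate for the remainder along a complex line. -/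
theorem norm_sub_taylorPoly_le {d : ℕ} {h : CSpace d → ℂ} (p x : CSpace d) (n : ℕ) {s M : ℝ}
    (hs0 : 0 < s) (hs1 : s < 1)
    (hh : ∀ t : ℂ, ‖t‖ ≤ s⁻¹ → AnalyticAt ℂ h (p + t • x))
    (hM : ∀ t : ℂ, ‖t‖ ≤ s⁻¹ → ‖h (p + t • x)‖ ≤ M) :
    ‖h (p + x) - taylorPoly n h p x‖ ≤ M * s ^ (n + 1) / (1 - s) := by
  set F : ℂ → ℂ := fun t => h (p + t • x) with hF
  have hd : DifferentiableOn ℂ F (Metric.closedBall 0 s⁻¹) := by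
    intro t ht
    refine DifferentiableAt.differentiableWithinAt ?_
    exact (hh t (by simpa using ht)).differentiableAt.comp t (by fun_prop)
  -- The point `p + x` is `t = 1`, strictly inside the disc of radius `s⁻¹ > 1`. Cauchy's estimate
  -- on the boundary circle then gives the decay `s ^ k` of the Taylor terms at `1`.
  have h1 : (1 : ℂ) ∈ Metric.ball (0 : ℂ) s⁻¹ := by
    simpa using (one_lt_inv₀ hs0).2 hs1
  have hsum := Complex.hasSum_taylorSeries_on_ball (hd.mono Metric.ball_subset_closedBall) h1
  have hbound : ∀ k : ℕ, ‖((k.factorial : ℂ))⁻¹ • ((1 : ℂ) - 0) ^ k • iteratedDeriv k F 0‖ ≤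
      M * s ^ k := by
    intro k
    have h2 := Complex.norm_iteratedDeriv_le_of_forall_mem_sphere_norm_le (f := F) (c := 0)
      (C := M) k (inv_pos.2 hs0)
      (DifferentiableOn.diffContOnCl (by rwa [closure_ball _ (inv_pos.2 hs0).ne']))
      (fun t ht => hM t (by simpa using (mem_sphere_zero_iff_norm.1 ht).le))
    have h3 : (0 : ℝ) < k.factorial := Nat.cast_pos.2 (Nat.factorial_pos k)
    rw [sub_zero, one_pow, one_smul, norm_smul, norm_inv, Complex.norm_natCast]
    calc (k.factorial : ℝ)⁻¹ * ‖iteratedDeriv k F 0‖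
        ≤ (k.factorial : ℝ)⁻¹ * (k.factorial * M / s⁻¹ ^ k) := by gcongr
      _ = M * s ^ k := by rw [inv_pow]; field_simp
  have htay : ∑ k ∈ Finset.range (n + 1),
      ((k.factorial : ℂ))⁻¹ • ((1 : ℂ) - 0) ^ k • iteratedDeriv k F 0 = taylorPoly n h p x := by
    rw [taylorPoly, sum_multiIdx (fun α => (∏ i, x i ^ α i) / (∏ i, (α i).factorial : ℕ) *
      multiDeriv α h p)]
    refine Finset.sum_congr rfl fun k _ => ?_
    have h2 := iteratedDeriv_line p x k (t := 0) (hh 0 (by simpa using hs0.le))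
    rw [zero_smul, add_zero, symbolApply_linear_pow, ← Finset.mul_sum] at h2
    rw [hF, h2, sub_zero, one_pow, one_smul, smul_eq_mul, ← mul_assoc,
      inv_mul_cancel₀ (Nat.cast_ne_zero.2 (Nat.factorial_ne_zero _)), one_mul]
  have hF1 : F 1 = h (p + x) := by simp [hF]
  rw [hF1] at hsum
  have htail := (hasSum_nat_add_iff' (n + 1)).2 hsum
  rw [htay] at htail
  have hgeo : HasSum (fun k : ℕ => M * s ^ (k + (n + 1))) (M * s ^ (n + 1) / (1 - s)) := by
    have := (hasSum_geometric_of_lt_one hs0.le hs1).mul_left (M * s ^ (n + 1))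
    rw [← div_eq_mul_inv] at this
    refine this.congr_fun ?_
    intro k
    ring
  exact htail.norm_le_of_bounded hgeo fun k => hbound _

/-! ### The matrix of the push-forward through Taylor coefficients -/

/-- The coefficient of `u_{p,α}` in the expansion at `p` of a holomorphic function `h`. -/
def fockCoeff {d : ℕ} (p : CSpace d) (α : Fin d → ℕ) (h : CSpace d → ℂ) : ℂ :=
  ((Real.exp (‖p‖ ^ 2 / 2) / Real.sqrt (∏ i, (α i).factorial : ℕ) : ℝ) : ℂ) *
    multiDeriv α (fun w => expFun (-p) w * h w) p

theorem expFun_neg_mul_expFun {d : ℕ} (p ζ w : CSpace d) :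
    expFun (-p) w * expFun ζ w = expFun (ζ - p) w := by
  rw [expFun, expFun, expFun, ← Complex.exp_add, inner_sub_left, inner_neg_left]
  congr 1
  ring

theorem multiDeriv_expFun {d : ℕ} (α : Fin d → ℕ) (ζ z : CSpace d) :
    multiDeriv α (expFun ζ) z = (∏ i, starRingEnd ℂ (ζ i) ^ α i) * expFun ζ z := by
  rw [multiDeriv, pdList_expFun, coordList_prod]
  rfl

/-- As `e_{-p} e_ζ = e_{ζ-p}`, the derivative at `p` produces `conj (ζ-p)^α` and the factor `exp
(-‖p‖²)`, which turns the normalisation `exp (‖p‖²/2)` of the coefficient into the `exp (-‖p‖²/2)`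
of the basis function. -/
theorem conj_fockCoeff_expFun {d : ℕ} (p : CSpace d) (α : Fin d → ℕ) (ζ : CSpace d) :
    starRingEnd ℂ (fockCoeff p α (expFun ζ)) = fockBasisFun p α ζ := by
  have h1 : (fun w => expFun (-p) w * expFun ζ w) = expFun (ζ - p) :=
    funext fun w => expFun_neg_mul_expFun p ζ w
  have h2 : starRingEnd ℂ (expFun (ζ - p) p) = expFun p ζ * (Real.exp (-‖p‖ ^ 2) : ℝ) := by
    rw [expFun, expFun, ← Complex.exp_conj, inner_conj_symm, inner_sub_right, Complex.ofReal_exp,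
      ← Complex.exp_add, inner_self_eq_norm_sq_to_K]
    congr 1
    push_cast
    simp [sub_eq_add_neg]
  have h3 : Real.exp (‖p‖ ^ 2 / 2) * Real.exp (-‖p‖ ^ 2) = Real.exp (-‖p‖ ^ 2 / 2) := by
    rw [← Real.exp_add]
    congr 1
    ring
  rw [fockCoeff, h1, multiDeriv_expFun, map_mul, map_mul, h2, fockBasisFun, ← h3,
    Complex.conj_ofReal, map_prod]
  simp only [map_pow, Complex.conj_conj, PiLp.sub_apply]
  push_cast
  ring

theorem totalDegree_prod_X_sub_C_le {d : ℕ} (c : Fin d → ℂ) (α : Fin d → ℕ) :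
    (∏ i, (MvPolynomial.X i - MvPolynomial.C (c i)) ^ α i :
      MvPolynomial (Fin d) ℂ).totalDegree ≤ ∑ i, α i := by
  refine (MvPolynomial.totalDegree_finsetProd _ _).trans ?_
  refine Finset.sum_le_sum fun i _ => (MvPolynomial.totalDegree_pow _ _).trans ?_
  refine (Nat.mul_le_mul_left _ ((MvPolynomial.totalDegree_sub_C_le _ _).trans
    (MvPolynomial.totalDegree_X i).le)).trans (by simp)

/-- The functional in `𝔇_{p,n}` whose transform is `u_{p,α}`. -/
theorem exists_jet_fockCoeff {d : ℕ} {S : Set (CSpace d)} {p : CSpace d} (hp : p ∈ S) {n : ℕ}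
    (α : MultiIdx d n) :
    ∃ φ ∈ jetSpace hp n, (∀ (h : CSpace d → ℂ) (hh : AnalyticOnNhd ℂ h S),
        φ.1 (HolGerm.mk h hh) = fockCoeff p α.1 h) ∧
      fourierBorel S φ = fockBasisFun p α.1 := by
  -- Conjugation by `e_{-p}` shifts the symbol, so the coefficient functional is the constant
  -- coefficient operator with symbol `P`; its degree is at most `|α| ≤ n`, so it stays in the jet
  -- space.
  set P : MvPolynomial (Fin d) ℂ :=
    ∏ i, (MvPolynomial.X i - MvPolynomial.C (starRingEnd ℂ (p i))) ^ α.1 i with hP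
  set c : ℂ := ((Real.exp (‖p‖ ^ 2 / 2) / Real.sqrt (∏ i, (α.1 i).factorial : ℕ) : ℝ) : ℂ) *
    expFun (-p) p with hc
  set φ : AnalyticFunctional S := c • ∑ s ∈ P.support, P.coeff s • jetFunctional hp s with hφ
  have key : ∀ (h : CSpace d → ℂ) (hh : AnalyticOnNhd ℂ h S),
      φ.1 (HolGerm.mk h hh) = fockCoeff p α.1 h := by
    intro h hh
    rw [fockCoeff, multiDeriv_expFun_neg_mul p α.1 (hh p hp), symbolApply_eq_sum, ← mul_assoc,
      ← hP, ← hc]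
    simp only [hφ, SetLike.val_smul, AddSubmonoidClass.coe_finsetSum, LinearMap.smul_apply,
      LinearMap.sum_apply, smul_eq_mul, jetFunctional_mk]
  refine ⟨φ, ?_, key, ?_⟩
  · refine Submodule.smul_mem _ _ (Submodule.sum_mem _ fun s hs => Submodule.smul_mem _ _
      (Submodule.subset_span ⟨⟨fun i => s i, ?_⟩, rfl⟩))
    have := (MvPolynomial.le_totalDegree hs).trans
      ((totalDegree_prod_X_sub_C_le _ α.1).trans α.2)
    rwa [Finsupp.sum_fintype _ _ (by simp)] at this
  · funext ζ
    rw [← conj_fockCoeff_expFun, ← key (expFun ζ) (expFun_analytic ζ S)]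
    rfl

/-- The truncated exponent is harmless: if `i` is differentiated more than `β i` times, the
descending factorial vanishes. -/
theorem pdList_const_mul_monomial {d : ℕ} (q : CSpace d) (a : ℂ) (β : Fin d → ℕ)
    (l : List (Fin d)) :
    pdList l (fun w => a * ∏ i, (w i - q i) ^ β i) = fun w =>
      a * ∏ i, ((β i).descFactorial (l.count i) : ℂ) * (w i - q i) ^ (β i - l.count i) := by
  induction l with
  | nil => simp [pdList]
  | cons j l ih =>
    have h1 : pdList (j :: l) (fun w : CSpace d => a * ∏ i, (w i - q i) ^ β i) =
      pd j (pdList l fun w => a * ∏ i, (w i - q i) ^ β i) := rfl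
    rw [h1, ih]
    funext w
    have h2 : ∀ i, HasFDerivAt (fun w : CSpace d =>
        ((β i).descFactorial (l.count i) : ℂ) * (w i - q i) ^ (β i - l.count i))
        (((β i).descFactorial (l.count i) : ℂ) • ((β i - l.count i : ℕ) •
          (w i - q i) ^ (β i - l.count i - 1)) • (EuclideanSpace.proj i : CSpace d →L[ℂ] ℂ)) w := by
      intro i
      have h3 : HasFDerivAt (fun w : CSpace d => w i - q i)
          (EuclideanSpace.proj i : CSpace d →L[ℂ] ℂ) w :=
        (EuclideanSpace.proj i : CSpace d →L[ℂ] ℂ).hasFDerivAt.sub_const _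
      have h4 := (h3.pow (β i - l.count i)).const_mul ((β i).descFactorial (l.count i) : ℂ)
      exact h4
    have h3 := (HasFDerivAt.finsetProd (u := Finset.univ) fun i _ => h2 i).const_mul a
    rw [pd, h3.fderiv]
    have h5 : ∀ i, (EuclideanSpace.proj i : CSpace d →L[ℂ] ℂ) (EuclideanSpace.single j 1) =
        (Pi.single j (1 : ℂ) : Fin d → ℂ) i := fun i => rfl
    simp only [smul_apply, sum_apply, h5, smul_eq_mul]
    congr 1
    rw [Finset.sum_eq_single j]
    · rw [← Finset.mul_prod_erase _ _ (Finset.mem_univ j), mul_comm]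
      congr 1
      · simp [Nat.descFactorial_succ, Nat.sub_sub]
        ring
      · refine Finset.prod_congr rfl fun i hi => ?_
        rw [List.count_cons_of_ne (Finset.ne_of_mem_erase hi).symm]
    · intro i _ hij
      simp [hij]
    · simp

theorem multiDeriv_const_mul_monomial {d : ℕ} (q : CSpace d) (a : ℂ) (β γ : Fin d → ℕ) :
    multiDeriv γ (fun w => a * ∏ i, (w i - q i) ^ β i) q =
      if β = γ then a * (∏ i, (γ i).factorial : ℕ) else 0 := by
  rw [multiDeriv, pdList_const_mul_monomial]
  simp only [coordList_count, sub_self]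
  split_ifs with h
  · subst h
    simp [Nat.descFactorial_self]
  · obtain ⟨i, hi⟩ := Function.ne_iff.1 h
    rw [Finset.prod_eq_zero (Finset.mem_univ i), mul_zero]
    -- Either too many derivatives are taken in the coordinate `i`, or a positive power of `w i - q
    -- i` survives and vanishes at `q`.
    rcases lt_or_gt_of_ne hi with h1 | h1
    · rw [Nat.descFactorial_eq_zero_iff_lt.2 h1]
      simp
    · rw [zero_pow (by omega), mul_zero]

/-- Biorthogonality: the factor `e_{-q}` cancels the exponential of the basis function and leaves a
monomial centred at `q`. This is what allows matrix entries to be read off by testing functionals on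
basis functions. -/
theorem fockCoeff_fockBasisFun {d : ℕ} (q : CSpace d) (β γ : Fin d → ℕ) :
    fockCoeff q γ (fockBasisFun q β) = if β = γ then 1 else 0 := by
  have h1 : (fun w => expFun (-q) w * fockBasisFun q β w) = fun w =>
      ((Real.exp (-‖q‖ ^ 2 / 2) / Real.sqrt (∏ i, (β i).factorial : ℕ) : ℝ) : ℂ) *
        ∏ i, (w i - q i) ^ β i := by
    funext w
    have h2 : expFun (-q) w * expFun q w = 1 := by
      rw [expFun_neg_mul_expFun, sub_self]
      simp [expFun]
    rw [fockBasisFun, ← mul_assoc, mul_comm, ← mul_assoc, mul_comm (expFun q w)]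
    rw [h2, one_mul]
  rw [fockCoeff, h1, multiDeriv_const_mul_monomial]
  split_ifs with h
  · subst h
    set F : ℕ := ∏ i, (β i).factorial with hF
    have hF0 : (0 : ℝ) < F := Nat.cast_pos.2 (Finset.prod_pos fun i _ => Nat.factorial_pos _)
    have h3 : Real.exp (‖q‖ ^ 2 / 2) / √F * (Real.exp (-‖q‖ ^ 2 / 2) / √F * F) = 1 := by
      have h4 : Real.exp (‖q‖ ^ 2 / 2) * Real.exp (-‖q‖ ^ 2 / 2) = 1 := by
        rw [← Real.exp_add, neg_div, add_neg_cancel, Real.exp_zero]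
      have h5 : √(F : ℝ) * √F = F := Real.mul_self_sqrt hF0.le
      have h6 : √(F : ℝ) ≠ 0 := (Real.sqrt_pos.2 hF0).ne'
      calc _ = (Real.exp (‖q‖ ^ 2 / 2) * Real.exp (-‖q‖ ^ 2 / 2)) * (F / (√F * √F)) := by
            field_simp
        _ = 1 := by rw [h4, h5, div_self hF0.ne', one_mul]
    exact_mod_cast h3
  · rw [mul_zero]

theorem fockBasisFun_analytic {d : ℕ} (q : CSpace d) (β : Fin d → ℕ) (S : Set (CSpace d)) :
    AnalyticOnNhd ℂ (fockBasisFun q β) S := by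
  intro z _
  refine AnalyticAt.mul (analyticAt_const.mul ?_) (expFun_analytic q Set.univ z (Set.mem_univ _))
  refine Finset.analyticAt_fun_prod _ fun i _ => AnalyticAt.pow ?_ _
  exact ((EuclideanSpace.proj i : CSpace d →L[ℂ] ℂ).analyticAt z).sub analyticAt_const

/-- The entries of `C_m` are conjugates of the expansion coefficients of `v_{f(p),β} ∘ f`. -/
theorem conj_pushforwardMatrix {d r : ℕ} {S : Set (CSpace d)} {p : CSpace d} (hp : p ∈ S)
    (f : CSpace d → CSpace r) (hf : AnalyticOnNhd ℂ f S) (m : ℕ) (β : MultiIdx r m)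
    (α : MultiIdx d m) :
    starRingEnd ℂ (pushforwardMatrix hp f hf m β α) =
      fockCoeff p α.1 (fockBasisFun (f p) β.1 ∘ f) := by
  obtain ⟨φ, hφm, hφ, hφFB⟩ := exists_jet_fockCoeff hp α
  choose ψ hψm hψ hψFB using fun γ : MultiIdx r m =>
    exists_jet_fockCoeff (Set.mem_univ (f p)) γ
  set M := pushforwardMatrix hp f hf m with hM
  have h1 : (fourierBorelEquiv hp m).symm (fockBasis hp m α) = ⟨φ, hφm⟩ := by
    rw [LinearEquiv.symm_apply_eq]
    refine Subtype.ext ?_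
    rw [fockBasis_apply]
    exact hφFB.symm
  have h2 : (pushforwardFB hp f hf m (fockBasis hp m α) : CSpace r → ℂ) =
      fourierBorel Set.univ (pushforward f hf φ) := by
    change fourierBorel Set.univ (pushforward f hf
      ((fourierBorelEquiv hp m).symm (fockBasis hp m α)).1) = _
    rw [h1]
  have h3 : pushforwardFB hp f hf m (fockBasis hp m α) =
      ∑ γ, M γ α • fockBasis (Set.mem_univ (f p)) m γ := by
    rw [← (fockBasis (Set.mem_univ (f p)) m).sum_repr (pushforwardFB hp f hf m (fockBasis hp m α))]
    simp only [hM, pushforwardMatrix, LinearMap.toMatrix_apply]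
  -- The column expansion of `C_m` is pulled back from transforms to functionals. The transform is
  -- antilinear, which is where the conjugates come from.
  have h4 : (∑ γ, starRingEnd ℂ (M γ α) • (⟨ψ γ, hψm γ⟩ : jetSpace (Set.mem_univ (f p)) m)) =
      ⟨pushforward f hf φ, pushforward_mem_jetSpace hp f hf m φ hφm⟩ := by
    apply (fourierBorelEquiv (Set.mem_univ (f p)) m).injective
    rw [map_sum]
    simp only [LinearEquiv.map_smulₛₗ, Complex.conj_conj]
    refine Subtype.ext ?_
    change _ = fourierBorel Set.univ (pushforward f hf φ)
    rw [← h2, h3]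
    congr 1
    refine Finset.sum_congr rfl fun γ _ => ?_
    congr 1
    refine Subtype.ext ?_
    rw [fockBasis_apply]
    exact hψFB γ
  -- Evaluation on `v_{f(p),β}` isolates the coefficient with index `β` by biorthogonality.
  have h5 := congrArg (fun χ : jetSpace (Set.mem_univ (f p)) m =>
    χ.1.1 (HolGerm.mk (fockBasisFun (f p) β.1) (fockBasisFun_analytic _ _ _))) h4
  simp only [AddSubmonoidClass.coe_finsetSum, SetLike.val_smul, LinearMap.sum_apply,
    LinearMap.smul_apply, hψ, fockCoeff_fockBasisFun, smul_eq_mul, mul_ite, mul_one,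
    mul_zero] at h5
  rw [Finset.sum_eq_single β (fun γ _ hγ => if_neg fun h => hγ (Subtype.ext h).symm) (by simp),
    if_pos rfl] at h5
  rw [h5]
  exact hφ (fockBasisFun (f p) β.1 ∘ f) fun z hz =>
    (fockBasisFun_analytic _ _ Set.univ (f z) (Set.mem_univ _)).comp (hf z hz)

/-! ### A tail bound for sums of independent vectors in a Hilbert space -/

/-- The power series of `cosh u` has nonnegative coefficients in `u²`, so `cosh` is a convex
function of `u²`; convexity is applied term by term. -/
theorem cosh_le_of_sq_eq {u v w θ : ℝ} (h0 : 0 ≤ θ) (h1 : θ ≤ 1)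
    (h : u ^ 2 = θ * v ^ 2 + (1 - θ) * w ^ 2) :
    Real.cosh u ≤ θ * Real.cosh v + (1 - θ) * Real.cosh w := by
  refine hasSum_le (fun k => ?_) (Real.hasSum_cosh u)
    (((Real.hasSum_cosh v).mul_left θ).add ((Real.hasSum_cosh w).mul_left (1 - θ)))
  have hc := (convexOn_pow (𝕜 := ℝ) k).2 (sq_nonneg v) (sq_nonneg w) h0 (sub_nonneg.2 h1)
    (by ring)
  simp only [smul_eq_mul, ← h] at hc
  have hf : (0 : ℝ) < (2 * k).factorial := Nat.cast_pos.2 (Nat.factorial_pos _)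
  rw [← mul_div_assoc, ← mul_div_assoc, ← add_div, pow_mul, pow_mul, pow_mul]
  gcongr

section Concentration

variable {H : Type*} [NormedAddCommGroup H] [InnerProductSpace ℂ H]

/-- With `a = ‖x‖`, `b = ‖y‖` and `s` the cosine of the real angle, `‖x+y‖²` is the convex
combination of `(a+b)²` and `(a-b)²` with weights `(1±s)/2`. Convexity yields `cosh a cosh b + s
sinh a sinh b`. Writing `sinh b = b + (sinh b - b)` isolates a term linear in `y`, which disappears
on averaging over centred `y`. For `x = 0` the quotient `sinh ‖x‖ / ‖x‖` is `0` by convention. -/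
theorem cosh_norm_add_le (x y : H) :
    Real.cosh ‖x + y‖ ≤ Real.cosh ‖x‖ * (Real.exp ‖y‖ - ‖y‖) +
      Real.sinh ‖x‖ / ‖x‖ * (inner ℂ x y).re := by
  have hs : ‖y‖ ≤ Real.sinh ‖y‖ := Real.self_le_sinh_iff.2 (norm_nonneg y)
  have hexp : Real.exp ‖y‖ = Real.cosh ‖y‖ + Real.sinh ‖y‖ := (Real.cosh_add_sinh _).symm
  rcases eq_or_ne x 0 with rfl | hx
  · simp only [zero_add, norm_zero, Real.cosh_zero, Real.sinh_zero, inner_zero_left]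
    simp only [zero_div, zero_mul, one_mul, add_zero, hexp]
    linarith
  rcases eq_or_ne y 0 with rfl | hy
  · simp
  set a := ‖x‖ with ha
  set b := ‖y‖ with hb
  have ha0 : 0 < a := norm_pos_iff.2 hx
  have hb0 : 0 < b := norm_pos_iff.2 hy
  set c := (inner ℂ x y).re with hc
  have hcs : |c| ≤ a * b := (Complex.abs_re_le_norm _).trans (norm_inner_le_norm x y)
  have hab : 0 < a * b := mul_pos ha0 hb0
  set s := c / (a * b) with hsdef
  have hcs' : c = s * (a * b) := by rw [hsdef]; field_simp
  have hs1 : s ≤ 1 := (div_le_one hab).2 ((le_abs_self c).trans hcs)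
  have hs2 : -1 ≤ s := by
    rw [hsdef, le_div_iff₀ hab]
    linarith [neg_abs_le c]
  have hsq : ‖x + y‖ ^ 2 = (1 + s) / 2 * (a + b) ^ 2 + (1 - (1 + s) / 2) * (a - b) ^ 2 := by
    have := norm_add_sq (𝕜 := ℂ) x y
    simp only [RCLike.re_to_complex] at this
    rw [this, ← hc, hcs']
    ring
  have key := cosh_le_of_sq_eq (by linarith) (by linarith) hsq
  rw [Real.cosh_add, Real.cosh_sub] at key
  have hsa : 0 ≤ Real.sinh a := Real.sinh_nonneg_iff.2 ha0.le
  have hsc : Real.sinh a ≤ Real.cosh a := (Real.sinh_lt_cosh a).le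
  have e1 : s * Real.sinh a * (Real.sinh b - b) ≤ Real.cosh a * (Real.sinh b - b) := by
    refine mul_le_mul_of_nonneg_right ?_ (sub_nonneg.2 hs)
    nlinarith
  have e2 : Real.sinh a / a * c = s * Real.sinh a * b := by
    rw [hcs']
    field_simp
  rw [e2, hexp]
  nlinarith

theorem exp_sub_self_le {b : ℝ} (h0 : 0 ≤ b) (h1 : b ≤ 1) :
    Real.exp b - b ≤ 1 + 3 / 4 * b ^ 2 := by
  have h := Real.exp_bound (x := b) (by rwa [abs_of_nonneg h0]) (n := 2) (by norm_num)
  rw [abs_le] at h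
  have h2 := h.2
  norm_num [Finset.sum_range_succ, Nat.factorial] at h2
  linarith

variable [MeasurableSpace H] [BorelSpace H] [SecondCountableTopology H] [CompleteSpace H]

/-- The linear term integrates to zero, and `1 + 3v/4 ≤ exp (3v/4)`. The bound is multiplicative in
`cosh ‖x‖`, so it can be iterated over independent summands without any dependence on the dimension.
-/
theorem lintegral_cosh_norm_add_le (ν : Measure H) [IsProbabilityMeasure ν] {v : ℝ}
    (hb : ∀ᵐ y ∂ν, ‖y‖ ≤ 1) (hm : ∫ y, y ∂ν = 0) (hv : ∫ y, ‖y‖ ^ 2 ∂ν ≤ v) (x : H) :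
    ∫⁻ y, ENNReal.ofReal (Real.cosh ‖x + y‖) ∂ν ≤
      ENNReal.ofReal (Real.cosh ‖x‖) * ENNReal.ofReal (Real.exp (3 / 4 * v)) := by
  have hid : Integrable (fun y : H => y) ν :=
    Integrable.of_bound aestronglyMeasurable_id 1 hb
  have hsq : Integrable (fun y : H => ‖y‖ ^ 2) ν := by
    refine Integrable.of_bound (by fun_prop) 1 ?_
    filter_upwards [hb] with y hy
    rw [norm_pow, norm_norm]
    exact pow_le_one₀ (norm_nonneg y) hy
  have hin : Integrable (fun y : H => (inner ℂ x y).re) ν := 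
    (hid.const_inner (𝕜 := ℂ) x).re
  set F : H → ℝ := fun y => Real.cosh ‖x‖ * (1 + 3 / 4 * ‖y‖ ^ 2) +
    Real.sinh ‖x‖ / ‖x‖ * (inner ℂ x y).re with hF
  have hle : ∀ᵐ y ∂ν, Real.cosh ‖x + y‖ ≤ F y := by
    filter_upwards [hb] with y hy
    refine (cosh_norm_add_le x y).trans (add_le_add ?_ le_rfl)
    exact mul_le_mul_of_nonneg_left (exp_sub_self_le (norm_nonneg y) hy) (Real.cosh_pos _).le
  have hq : Integrable (fun y : H => 1 + 3 / 4 * ‖y‖ ^ 2) ν :=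
    (integrable_const 1).add (hsq.const_mul (3 / 4))
  have hFi : Integrable F ν := (hq.const_mul _).add (hin.const_mul _)
  have hFint : ∫ y, F y ∂ν = Real.cosh ‖x‖ * (1 + 3 / 4 * ∫ y, ‖y‖ ^ 2 ∂ν) := by
    have h0 : ∫ y, (inner ℂ x y).re ∂ν = 0 := by
      have h1 : ∫ y, (inner ℂ x y).re ∂ν = (∫ y, inner ℂ x y ∂ν).re :=
        integral_re (𝕜 := ℂ) (hid.const_inner x)
      rw [h1, integral_inner hid, hm, inner_zero_right, Complex.zero_re]
    rw [hF, integral_add (hq.const_mul _) (hin.const_mul _), integral_const_mul, integral_const_mul, h0,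
      integral_add (integrable_const 1) (hsq.const_mul (3 / 4)), integral_const_mul]
    simp
  calc ∫⁻ y, ENNReal.ofReal (Real.cosh ‖x + y‖) ∂ν ≤ ∫⁻ y, ENNReal.ofReal (F y) ∂ν := by
        refine lintegral_mono_ae ?_
        filter_upwards [hle] with y hy using ENNReal.ofReal_le_ofReal hy
    _ = ENNReal.ofReal (∫ y, F y ∂ν) := by
        refine (ofReal_integral_eq_lintegral_ofReal hFi ?_).symm
        filter_upwards [hle] with y hy using (Real.cosh_pos _).le.trans hy
    _ ≤ ENNReal.ofReal (Real.cosh ‖x‖ * Real.exp (3 / 4 * v)) := by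
        refine ENNReal.ofReal_le_ofReal ?_
        rw [hFint]
        refine mul_le_mul_of_nonneg_left ?_ (Real.cosh_pos _).le
        have := Real.add_one_le_exp (3 / 4 * v)
        linarith
    _ = _ := ENNReal.ofReal_mul (Real.cosh_pos _).le

/-- One summand is integrated out at a time, with the partial sum frozen by independence and
Tonelli's theorem. Lower integrals avoid any integrability check. -/
theorem lintegral_cosh_norm_sum_le {Ω ι : Type*} [MeasurableSpace Ω] {P : Measure Ω}
    [IsProbabilityMeasure P] {Y : ι → Ω → H} (hY : ∀ i, Measurable (Y i)) (hind : iIndepFun Y P)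
    {v : ℝ} (hb : ∀ i, ∀ᵐ ω ∂P, ‖Y i ω‖ ≤ 1) (hm : ∀ i, ∫ ω, Y i ω ∂P = 0)
    (hv : ∀ i, ∫ ω, ‖Y i ω‖ ^ 2 ∂P ≤ v) (s : Finset ι) :
    ∫⁻ ω, ENNReal.ofReal (Real.cosh ‖∑ i ∈ s, Y i ω‖) ∂P ≤
      ENNReal.ofReal (Real.exp (3 / 4 * v)) ^ s.card := by
  classical
  induction s using Finset.induction_on with
  | empty => simp
  | insert i s hi ih =>
    set S : Ω → H := ∑ j ∈ s, Y j with hS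
    have hSm : Measurable S := by
      have h0 := Finset.measurable_fun_sum s fun j _ => hY j
      rwa [← Finset.sum_fn] at h0
    have hSi : S ⟂ᵢ[P] Y i := hind.indepFun_finsetSum_of_notMem hY hi
    have hlaw := hSi.map_prod_eq_prod_map_map hSm.aemeasurable (hY i).aemeasurable
    have hcosh : Measurable fun q : H × H => ENNReal.ofReal (Real.cosh ‖q.1 + q.2‖) :=
      (Real.continuous_cosh.comp (by fun_prop : Continuous fun q : H × H =>
        ‖q.1 + q.2‖)).measurable.ennreal_ofReal
    have hcosh1 : Measurable fun x : H => ENNReal.ofReal (Real.cosh ‖x‖) :=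
      (Real.continuous_cosh.comp continuous_norm).measurable.ennreal_ofReal
    have : IsProbabilityMeasure (P.map (Y i)) :=
      Measure.isProbabilityMeasure_map (hY i).aemeasurable
    have : IsProbabilityMeasure (P.map S) := Measure.isProbabilityMeasure_map hSm.aemeasurable
    have step : ∀ x : H, ∫⁻ y, ENNReal.ofReal (Real.cosh ‖x + y‖) ∂(P.map (Y i)) ≤
        ENNReal.ofReal (Real.cosh ‖x‖) * ENNReal.ofReal (Real.exp (3 / 4 * v)) := by
      refine lintegral_cosh_norm_add_le _ ?_ ?_ ?_
      · rw [ae_map_iff (hY i).aemeasurable (measurableSet_le measurable_norm measurable_const)]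
        exact hb i
      · rw [integral_map (f := fun y : H => y) (hY i).aemeasurable aestronglyMeasurable_id]
        exact hm i
      · rw [integral_map (hY i).aemeasurable (by fun_prop)]
        exact hv i
    calc ∫⁻ ω, ENNReal.ofReal (Real.cosh ‖∑ j ∈ insert i s, Y j ω‖) ∂P
        = ∫⁻ ω, ENNReal.ofReal (Real.cosh ‖S ω + Y i ω‖) ∂P := by
          refine lintegral_congr fun ω => ?_
          rw [Finset.sum_insert hi, add_comm, hS, Finset.sum_apply]
      _ = ∫⁻ q, ENNReal.ofReal (Real.cosh ‖q.1 + q.2‖) ∂(P.map fun ω => (S ω, Y i ω)) :=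
          (lintegral_map hcosh (hSm.prodMk (hY i))).symm
      _ = ∫⁻ x, ∫⁻ y, ENNReal.ofReal (Real.cosh ‖x + y‖) ∂(P.map (Y i)) ∂(P.map S) := by
          rw [hlaw, lintegral_prod _ hcosh.aemeasurable]
      _ ≤ ∫⁻ x, ENNReal.ofReal (Real.cosh ‖x‖) * ENNReal.ofReal (Real.exp (3 / 4 * v))
            ∂(P.map S) := lintegral_mono step
      _ = (∫⁻ ω, ENNReal.ofReal (Real.cosh ‖∑ j ∈ s, Y j ω‖) ∂P) *
            ENNReal.ofReal (Real.exp (3 / 4 * v)) := by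
          rw [lintegral_mul_const _ hcosh1, lintegral_map hcosh1 hSm]
          simp only [hS, Finset.sum_apply]
      _ ≤ _ := by
          rw [Finset.card_insert_of_notMem hi, pow_succ]
          gcongr

/-- A dimension free exponential tail bound, in the spirit of Pinelis. -/
theorem measure_norm_sum_ge_le {Ω : Type*} [MeasurableSpace Ω] {P : Measure Ω}
    [IsProbabilityMeasure P] {N : ℕ} {Y : Fin N → Ω → H} (hY : ∀ i, Measurable (Y i))
    (hind : iIndepFun Y P) {v : ℝ} (hb : ∀ i, ∀ᵐ ω ∂P, ‖Y i ω‖ ≤ 1)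
    (hm : ∀ i, ∫ ω, Y i ω ∂P = 0) (hv : ∀ i, ∫ ω, ‖Y i ω‖ ^ 2 ∂P ≤ v) {τ : ℝ} (hτ : 0 ≤ τ) :
    P {ω | τ ≤ ‖∑ i, Y i ω‖} ≤ ENNReal.ofReal (2 * Real.exp (3 / 4 * v * N - τ)) := by
  have hSm : Measurable fun ω => ∑ i, Y i ω := Finset.measurable_fun_sum _ fun j _ => hY j
  have hcosh : Measurable fun ω => ENNReal.ofReal (Real.cosh ‖∑ i, Y i ω‖) :=
    (Real.continuous_cosh.measurable.comp hSm.norm).ennreal_ofReal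
  -- Markov's inequality for `cosh` with the threshold `exp τ / 2 ≤ cosh τ`, which accounts for the
  -- factor `2` in the tail.
  have h1 := mul_meas_ge_le_lintegral (μ := P) hcosh (ENNReal.ofReal (Real.exp τ / 2))
  have h2 := h1.trans (lintegral_cosh_norm_sum_le hY hind hb hm hv Finset.univ)
  rw [Finset.card_univ, Fintype.card_fin, ← ENNReal.ofReal_pow (Real.exp_pos _).le,
    ← Real.exp_nat_mul] at h2
  have h3 : P {ω | τ ≤ ‖∑ i, Y i ω‖} ≤ P {ω | ENNReal.ofReal (Real.exp τ / 2) ≤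
      ENNReal.ofReal (Real.cosh ‖∑ i, Y i ω‖)} := by
    refine measure_mono fun ω hω => ENNReal.ofReal_le_ofReal ?_
    have h4 : Real.cosh τ ≤ Real.cosh ‖∑ i, Y i ω‖ := by
      rw [Real.cosh_le_cosh, abs_of_nonneg hτ, abs_of_nonneg (norm_nonneg _)]
      exact hω
    refine le_trans ?_ h4
    rw [Real.cosh_eq]
    have := Real.exp_pos (-τ)
    linarith
  have hpos : 0 < Real.exp τ / 2 := by positivity
  have h5 : ENNReal.ofReal (2 * Real.exp (3 / 4 * v * N - τ)) =
      ENNReal.ofReal (Real.exp (N * (3 / 4 * v))) / ENNReal.ofReal (Real.exp τ / 2) := by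
    rw [← ENNReal.ofReal_div_of_pos hpos, Real.exp_sub]
    congr 1
    rw [mul_comm (N : ℝ)]
    field_simp
  rw [h5, ENNReal.le_div_iff_mul_le (Or.inl (by simpa using Real.exp_pos τ))
    (Or.inl ENNReal.ofReal_ne_top), mul_comm]
  exact (mul_le_mul_right h3 _).trans h2

end Concentration

/-! ### The empirical moment matrix -/

/-- The monomial `x^α`. -/
def mono {d n : ℕ} (x : CSpace d) (α : MultiIdx d n) : ℂ := ∏ i, x i ^ α.1 i

theorem continuous_mono {d n : ℕ} (α : MultiIdx d n) : Continuous fun x : CSpace d => mono x α := by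
  unfold mono
  fun_prop

theorem norm_mono_le {d n : ℕ} {x : CSpace d} {L : ℝ} (hL : 1 ≤ L) (hx : ∀ i, ‖x i‖ ≤ L)
    (α : MultiIdx d n) : ‖mono x α‖ ≤ L ^ n := by
  rw [mono, norm_prod]
  calc ∏ i, ‖x i ^ α.1 i‖ ≤ ∏ i, L ^ α.1 i := by
        refine Finset.prod_le_prod (fun _ _ => norm_nonneg _) fun i _ => ?_
        rw [norm_pow]
        exact pow_le_pow_left₀ (norm_nonneg _) (hx i) _
    _ = L ^ ∑ i, α.1 i := Finset.prod_pow_eq_pow_sum _ _ _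
    _ ≤ L ^ n := pow_le_pow_right₀ hL α.2

/-- The rank one matrix with entries `conj(x^α) x^β`, as a vector. -/
def dyad {d : ℕ} (n : ℕ) (x : CSpace d) : EuclideanSpace ℂ (MultiIdx d n × MultiIdx d n) :=
  WithLp.toLp 2 fun q => starRingEnd ℂ (mono x q.1) * mono x q.2

theorem continuous_dyad {d : ℕ} (n : ℕ) : Continuous (dyad n : CSpace d → _) := by
  refine (PiLp.continuous_toLp 2 _).comp (continuous_pi fun q => ?_)
  exact (Complex.continuous_conj.comp (continuous_mono q.1)).mul (continuous_mono q.2)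

theorem norm_dyad_le {d n : ℕ} {x : CSpace d} {L : ℝ} (hL : 1 ≤ L) (hx : ∀ i, ‖x i‖ ≤ L) :
    ‖dyad n x‖ ≤ L ^ (2 * n) * Fintype.card (MultiIdx d n) := by
  have hL0 : 0 ≤ L := zero_le_one.trans hL
  rw [EuclideanSpace.norm_eq]
  refine Real.sqrt_le_iff.2 ⟨by positivity, ?_⟩
  calc ∑ q, ‖dyad n x q‖ ^ 2 ≤ ∑ _q : MultiIdx d n × MultiIdx d n, (L ^ (2 * n)) ^ 2 := by
        refine Finset.sum_le_sum fun q _ => pow_le_pow_left₀ (norm_nonneg _) ?_ 2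
        change ‖starRingEnd ℂ (mono x q.1) * mono x q.2‖ ≤ _
        rw [norm_mul, RCLike.norm_conj, two_mul, pow_add]
        exact mul_le_mul (norm_mono_le hL hx _) (norm_mono_le hL hx _) (norm_nonneg _)
          (by positivity)
    _ = (L ^ (2 * n) * Fintype.card (MultiIdx d n)) ^ 2 := by
        rw [Finset.sum_const, Finset.card_univ, Fintype.card_prod, nsmul_eq_mul]
        push_cast
        ring

/-- The vector with entries `c_α conj(c_β)`. -/
def conjDyad {I : Type*} (c : I → ℂ) : EuclideanSpace ℂ (I × I) :=
  WithLp.toLp 2 fun q => c q.1 * starRingEnd ℂ (c q.2)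

/-- A rank one matrix has Frobenius norm `‖c‖²`. By Cauchy–Schwarz, closeness of two matrices in
Frobenius norm then controls their quadratic forms uniformly in `c`. -/
theorem norm_conjDyad {I : Type*} [Fintype I] (c : I → ℂ) :
    ‖conjDyad c‖ = ∑ α, ‖c α‖ ^ 2 := by
  rw [EuclideanSpace.norm_eq, Real.sqrt_eq_iff_mul_self_eq
    (Finset.sum_nonneg fun _ _ => by positivity) (Finset.sum_nonneg fun _ _ => by positivity),
    Finset.sum_mul_sum, ← Finset.sum_product']
  refine Finset.sum_congr rfl fun q _ => ?_
  change ‖c q.1 * starRingEnd ℂ (c q.2)‖ ^ 2 = _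
  rw [norm_mul, RCLike.norm_conj, mul_pow]

theorem inner_conjDyad {I : Type*} [Fintype I] (c : I → ℂ) (w : EuclideanSpace ℂ (I × I)) :
    inner ℂ (conjDyad c) w = ∑ α, ∑ β, starRingEnd ℂ (c α) * c β * w (α, β) := by
  rw [PiLp.inner_apply, Fintype.sum_prod_type]
  refine Finset.sum_congr rfl fun α _ => Finset.sum_congr rfl fun β _ => ?_
  change w (α, β) * starRingEnd ℂ (c α * starRingEnd ℂ (c β)) = _
  rw [map_mul, Complex.conj_conj]
  ring

/-- Pairing with `conjDyad c` evaluates a matrix as a quadratic form at `c`; on the rank one matrix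
of a sample point this is the squared modulus of a polynomial. -/
theorem inner_conjDyad_dyad {d n : ℕ} (c : MultiIdx d n → ℂ) (x : CSpace d) :
    inner ℂ (conjDyad c) (dyad n x) = ((‖∑ α, c α * mono x α‖ ^ 2 : ℝ) : ℂ) := by
  rw [inner_conjDyad]
  push_cast
  rw [← Complex.conj_mul', map_sum, Finset.sum_mul_sum]
  refine Finset.sum_congr rfl fun α _ => Finset.sum_congr rfl fun β _ => ?_
  change _ * _ * (starRingEnd ℂ (mono x α) * mono x β) = _
  rw [map_mul]
  ring

theorem inner_conjDyad_toLp {I : Type*} [Fintype I] (c : I → ℂ) (A : Matrix I I ℂ) :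
    inner ℂ (conjDyad c) (WithLp.toLp 2 fun q : I × I => A q.1 q.2) =
      star c ⬝ᵥ (A.mulVec c) := by
  rw [inner_conjDyad]
  simp only [dotProduct, Matrix.mulVec, Finset.mul_sum, Pi.star_apply, RCLike.star_def]
  refine Finset.sum_congr rfl fun α _ => Finset.sum_congr rfl fun β _ => ?_
  ring

section Moments

variable {d n : ℕ} {μ : Measure (CSpace d)} [IsProbabilityMeasure μ] {L : ℝ}

theorem integrable_dyad (hL : 1 ≤ L) (hμ : ∀ᵐ x ∂μ, ∀ i, ‖x i‖ ≤ L) :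
    Integrable (dyad n) μ := by
  refine Integrable.of_bound (continuous_dyad n).aestronglyMeasurable
    (L ^ (2 * n) * Fintype.card (MultiIdx d n)) ?_
  filter_upwards [hμ] with x hx using norm_dyad_le hL hx

theorem integral_dyad (hL : 1 ≤ L) (hμ : ∀ᵐ x ∂μ, ∀ i, ‖x i‖ ≤ L) :
    ∫ x, dyad n x ∂μ = WithLp.toLp 2 fun q => momentMatrix n μ q.1 q.2 := by
  ext q
  have h1 := (EuclideanSpace.proj q :
    EuclideanSpace ℂ (MultiIdx d n × MultiIdx d n) →L[ℂ] ℂ).integral_comp_comm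
      (integrable_dyad (n := n) hL hμ)
  exact h1.symm

theorem norm_integral_dyad_le (hL : 1 ≤ L) (hμ : ∀ᵐ x ∂μ, ∀ i, ‖x i‖ ≤ L) :
    ‖∫ x, dyad n x ∂μ‖ ≤ L ^ (2 * n) * Fintype.card (MultiIdx d n) := by
  have h1 : ∀ᵐ x ∂μ, ‖dyad n x‖ ≤ L ^ (2 * n) * Fintype.card (MultiIdx d n) := by
    filter_upwards [hμ] with x hx using norm_dyad_le hL hx
  simpa using norm_integral_le_of_norm_le_const h1

open scoped ComplexOrder in
theorem inner_conjDyad_integral_dyad_nonneg (hL : 1 ≤ L) (hμ : ∀ᵐ x ∂μ, ∀ i, ‖x i‖ ≤ L)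
    (c : MultiIdx d n → ℂ) : 0 ≤ inner ℂ (conjDyad c) (∫ x, dyad n x ∂μ) := by
  rw [← integral_inner (integrable_dyad hL hμ)]
  simp only [inner_conjDyad_dyad]
  rw [integral_complex_ofReal]
  exact_mod_cast integral_nonneg fun x => by positivity

open scoped ComplexOrder in
theorem momentMatrix_posSemidef (hL : 1 ≤ L) (hμ : ∀ᵐ x ∂μ, ∀ i, ‖x i‖ ≤ L) :
    (momentMatrix n μ).PosSemidef := by
  refine Matrix.PosSemidef.of_dotProduct_mulVec_nonneg (momentMatrix_isHermitian n μ) fun c => ?_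
  rw [← inner_conjDyad_toLp, ← integral_dyad hL hμ]
  exact inner_conjDyad_integral_dyad_nonneg hL hμ c

open scoped ComplexOrder in
theorem minEigenvalue_pos (hL : 1 ≤ L) (hμ : ∀ᵐ x ∂μ, ∀ i, ‖x i‖ ≤ L)
    (hu : IsUnit (momentMatrix n μ)) : 0 < minEigenvalue n μ := by
  have hp := ((momentMatrix_posSemidef (n := n) hL hμ).posDef_iff_isUnit).2 hu
  obtain ⟨α, hα⟩ := exists_eq_ciInf_of_finite
    (f := fun α => (momentMatrix_isHermitian n μ).eigenvalues α)
  rw [minEigenvalue, ← hα]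
  exact hp.eigenvalues_pos α

-- The Rayleigh bound: subtracting the least eigenvalue times the identity leaves a positive
-- semidefinite matrix, by the spectral theorem.
open scoped ComplexOrder in
theorem iInf_eigenvalues_mul_le {I : Type*} [Fintype I] [DecidableEq I]
    {A : Matrix I I ℂ} (hA : A.IsHermitian) (c : I → ℂ) :
    (⨅ i, hA.eigenvalues i) * ∑ i, ‖c i‖ ^ 2 ≤ (star c ⬝ᵥ A.mulVec c).re := by
  set l := ⨅ i, hA.eigenvalues i with hl
  set V : Matrix I I ℂ := (hA.eigenvectorUnitary : Matrix I I ℂ) with hV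
  have hVV : V * V.conjTranspose = 1 := Unitary.coe_mul_star_self hA.eigenvectorUnitary
  have hspec : A = V * Matrix.diagonal (RCLike.ofReal ∘ hA.eigenvalues) * V.conjTranspose := by
    have := hA.spectral_theorem
    rwa [Unitary.conjStarAlgAut_apply] at this
  have h1 : A - (l : ℂ) • (1 : Matrix I I ℂ) =
      V * Matrix.diagonal (fun i => ((hA.eigenvalues i - l : ℝ) : ℂ)) * V.conjTranspose := by
    have h2 : Matrix.diagonal (fun i => ((hA.eigenvalues i - l : ℝ) : ℂ)) =
        Matrix.diagonal (RCLike.ofReal ∘ hA.eigenvalues) - (l : ℂ) • (1 : Matrix I I ℂ) := by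
      ext i j
      by_cases hij : i = j
      · subst hij; simp
      · simp [hij]
    rw [h2, Matrix.mul_sub, Matrix.sub_mul, ← hspec, Matrix.mul_smul, Matrix.mul_one,
      Matrix.smul_mul, hVV]
  have h3 : (A - (l : ℂ) • (1 : Matrix I I ℂ)).PosSemidef := by
    rw [h1]
    refine (Matrix.PosSemidef.diagonal fun i => ?_).mul_mul_conjTranspose_same V
    have : l ≤ hA.eigenvalues i := ciInf_le (Finite.bddBelow_range _) i
    exact Complex.zero_le_real.2 (sub_nonneg.2 this)
  have h4 := h3.re_dotProduct_nonneg c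
  rw [Matrix.sub_mulVec, dotProduct_sub, Matrix.smul_mulVec, Matrix.one_mulVec,
    dotProduct_smul] at h4
  have h5 : star c ⬝ᵥ c = ((∑ i, ‖c i‖ ^ 2 : ℝ) : ℂ) := by
    push_cast
    exact Finset.sum_congr rfl fun i _ => Complex.conj_mul' (c i)
  rw [h5, smul_eq_mul, ← Complex.ofReal_mul, map_sub] at h4
  rw [RCLike.re_to_complex, RCLike.re_to_complex, Complex.ofReal_re] at h4
  linarith

theorem minEigenvalue_mul_le (hL : 1 ≤ L) (hμ : ∀ᵐ x ∂μ, ∀ i, ‖x i‖ ≤ L)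
    (c : MultiIdx d n → ℂ) :
    minEigenvalue n μ * ∑ α, ‖c α‖ ^ 2 ≤ (inner ℂ (conjDyad c) (∫ x, dyad n x ∂μ)).re := by
  rw [integral_dyad hL hμ, inner_conjDyad_toLp]
  exact iInf_eigenvalues_mul_le _ c

/-- The quadratic form is tested on the vector with all entries `1`. The bound ensures that the
rescaled summands of the concentration argument have norm at most `1`. -/
theorem minEigenvalue_le (hL : 1 ≤ L) (hμ : ∀ᵐ x ∂μ, ∀ i, ‖x i‖ ≤ L) :
    minEigenvalue n μ ≤ L ^ (2 * n) * Fintype.card (MultiIdx d n) := by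
  have h1 := minEigenvalue_mul_le (n := n) hL hμ 1
  have h2 := (Complex.re_le_norm _).trans
    (norm_inner_le_norm (𝕜 := ℂ) (conjDyad (1 : MultiIdx d n → ℂ)) (∫ x, dyad n x ∂μ))
  rw [norm_conjDyad] at h2
  have h3 : (0 : ℝ) < ∑ α : MultiIdx d n, ‖(1 : MultiIdx d n → ℂ) α‖ ^ 2 := by
    simp [Fintype.card_pos]
  refine le_trans ?_ (norm_integral_dyad_le hL hμ)
  refine le_of_mul_le_mul_right ?_ h3
  rw [mul_comm ‖_‖]
  exact h1.trans h2

/-- If the empirical moments are close to the moments of `μ` then the monomials are bounded below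
on the sample. -/
theorem le_sum_norm_sq_of_norm_sum_dyad_sub_le (hL : 1 ≤ L) (hμ : ∀ᵐ x ∂μ, ∀ i, ‖x i‖ ≤ L) {N : ℕ}
    (x : Fin N → CSpace d)
    (h : ‖∑ k, (dyad n (x k) - ∫ y, dyad n y ∂μ)‖ ≤ N * (7 / 8 * minEigenvalue n μ))
    (c : MultiIdx d n → ℂ) :
    N * (minEigenvalue n μ / 8) * ∑ α, ‖c α‖ ^ 2 ≤ ∑ k, ‖∑ α, c α * mono (x k) α‖ ^ 2 := by
  set D := ∫ y, dyad n y ∂μ with hD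
  have h1 := minEigenvalue_mul_le (n := n) hL hμ c
  have h2 : inner ℂ (conjDyad c) (∑ k, (dyad n (x k) - D)) =
      ((∑ k, ‖∑ α, c α * mono (x k) α‖ ^ 2 : ℝ) : ℂ) - N * inner ℂ (conjDyad c) D := by
    rw [inner_sum]
    simp only [inner_sub_right, inner_conjDyad_dyad, Finset.sum_sub_distrib, Finset.sum_const,
      Finset.card_univ, Fintype.card_fin, nsmul_eq_mul]
    push_cast
    rfl
  have h3 : -(‖conjDyad c‖ * ‖∑ k, (dyad n (x k) - D)‖) ≤
      (inner ℂ (conjDyad c) (∑ k, (dyad n (x k) - D))).re := by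
    have h4 := (Complex.abs_re_le_norm _).trans (norm_inner_le_norm (𝕜 := ℂ) (conjDyad c)
      (∑ k, (dyad n (x k) - D)))
    exact (abs_le.1 h4).1
  have h5 : (inner ℂ (conjDyad c) (∑ k, (dyad n (x k) - D))).re =
      ∑ k, ‖∑ α, c α * mono (x k) α‖ ^ 2 - N * (inner ℂ (conjDyad c) D).re := by
    rw [h2, Complex.sub_re, Complex.ofReal_re, ← Complex.ofReal_natCast, Complex.re_ofReal_mul]
  rw [h5, norm_conjDyad] at h3
  have hc0 : 0 ≤ ∑ α, ‖c α‖ ^ 2 := Finset.sum_nonneg fun _ _ => by positivity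
  have h6 := mul_le_mul_of_nonneg_left h hc0
  have h7 := mul_le_mul_of_nonneg_left h1 (Nat.cast_nonneg (α := ℝ) N)
  nlinarith

/-- The variance is the second moment minus `‖D‖²`. The crude bound `‖dyad - D‖ ≤ 2B` would lose a
factor `4`, too much for the stated sample size. -/
theorem integral_norm_dyad_sub_sq_le (hL : 1 ≤ L) (hμ : ∀ᵐ x ∂μ, ∀ i, ‖x i‖ ≤ L) :
    ∫ x, ‖dyad n x - ∫ y, dyad n y ∂μ‖ ^ 2 ∂μ ≤
      (L ^ (2 * n) * Fintype.card (MultiIdx d n)) ^ 2 := by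
  set D := ∫ y, dyad n y ∂μ with hD
  set B := L ^ (2 * n) * (Fintype.card (MultiIdx d n) : ℝ) with hB
  have hi := integrable_dyad (n := n) hL hμ
  have hin : Integrable (fun x => (inner ℂ D (dyad n x)).re) μ := (hi.const_inner (𝕜 := ℂ) D).re
  have h1 : ∀ᵐ x ∂μ, ‖dyad n x - D‖ ^ 2 ≤ B ^ 2 - 2 * (inner ℂ D (dyad n x)).re + ‖D‖ ^ 2 := by
    filter_upwards [hμ] with x hx
    have h2 := norm_sub_sq (𝕜 := ℂ) (dyad n x) D
    have h3 := pow_le_pow_left₀ (norm_nonneg _) (norm_dyad_le (n := n) hL hx) 2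
    have h4 : (inner ℂ (dyad n x) D).re = (inner ℂ D (dyad n x)).re := by
      rw [← inner_conj_symm, Complex.conj_re]
    simp only [RCLike.re_to_complex, h4] at h2
    rw [h2]
    linarith
  have h2 : ∫ x, (inner ℂ D (dyad n x)).re ∂μ = ‖D‖ ^ 2 := by
    have h3 : ∫ x, (inner ℂ D (dyad n x)).re ∂μ = (∫ x, inner ℂ D (dyad n x) ∂μ).re :=
      integral_re (𝕜 := ℂ) (hi.const_inner D)
    rw [h3, integral_inner hi, ← hD, inner_self_eq_norm_sq_to_K]
    norm_cast
  have hI : Integrable (fun x => B ^ 2 - 2 * (inner ℂ D (dyad n x)).re) μ :=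
    (integrable_const _).sub (hin.const_mul 2)
  calc ∫ x, ‖dyad n x - D‖ ^ 2 ∂μ
      ≤ ∫ x, (B ^ 2 - 2 * (inner ℂ D (dyad n x)).re + ‖D‖ ^ 2) ∂μ :=
        integral_mono_of_nonneg (Eventually.of_forall fun x => by positivity)
          (hI.add (integrable_const _)) h1
    _ = B ^ 2 - ‖D‖ ^ 2 := by
        rw [integral_add hI (integrable_const _), integral_sub (integrable_const _)
          (hin.const_mul 2), integral_const_mul, h2]
        simp
        ring
    _ ≤ B ^ 2 := by linarith [sq_nonneg ‖D‖]

theorem measure_norm_sum_dyad_sub_ge_le (hL : 1 ≤ L) (hμ : ∀ᵐ x ∂μ, ∀ i, ‖x i‖ ≤ L)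
    (hΛ : 0 < minEigenvalue n μ) {δ : ℝ} (hδ : 0 < δ) {N : ℕ}
    (hN : L ^ (4 * n) * (Fintype.card (MultiIdx d n) : ℝ) ^ 2 /
          minEigenvalue n μ ^ 2 * (4 * Real.log (2 / δ)) ≤ (N : ℝ))
    {Ω : Type*} [MeasurableSpace Ω] (P : Measure Ω) [IsProbabilityMeasure P]
    (z : Fin N → Ω → CSpace d) (hz : ∀ k, Measurable (z k)) (hind : iIndepFun z P)
    (hlaw : ∀ k, P.map (z k) = μ) :
    P {ω | N * (7 / 8 * minEigenvalue n μ) ≤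
      ‖∑ k, (dyad n (z k ω) - ∫ y, dyad n y ∂μ)‖} ≤ ENNReal.ofReal δ := by
  set D := ∫ y, dyad n y ∂μ with hD
  set Λ := minEigenvalue n μ with hΛdef
  set B := L ^ (2 * n) * (Fintype.card (MultiIdx d n) : ℝ) with hB
  have hΛB : Λ ≤ B := minEigenvalue_le hL hμ
  have hB0 : 0 < B := hΛ.trans_le hΛB
  -- The summands are centred and bounded by `2B`, so this scale makes them at most `Λ / B ≤ 1`. The
  -- tail exponent divided by `N Λ² / B²` becomes `3/16 - 7/16 = -1/4`, which is the constant `4` in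
  -- the condition on `N`.
  set l : ℝ := Λ / (2 * B ^ 2) with hl
  have hl0 : 0 < l := by positivity
  set g : CSpace d → EuclideanSpace ℂ (MultiIdx d n × MultiIdx d n) :=
    fun x => (l : ℂ) • (dyad n x - D) with hg
  have hgc : Continuous g := ((continuous_dyad n).sub (continuous_const (y := D))).const_smul (l : ℂ)
  have hgn : ∀ x, ‖g x‖ = l * ‖dyad n x - D‖ := fun x => by
    rw [hg, norm_smul, Complex.norm_real, Real.norm_of_nonneg hl0.le]
  have hb : ∀ k, ∀ᵐ ω ∂P, ‖g (z k ω)‖ ≤ 1 := by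
    intro k
    have h1 : ∀ᵐ x ∂μ, ‖g x‖ ≤ 1 := by
      filter_upwards [hμ] with x hx
      have h2 : ‖dyad n x - D‖ ≤ B + B :=
        (norm_sub_le _ _).trans (add_le_add (norm_dyad_le hL hx) (norm_integral_dyad_le hL hμ))
      rw [hgn]
      calc l * ‖dyad n x - D‖ ≤ l * (B + B) := by gcongr
        _ = Λ / B := by rw [hl]; field_simp; ring
        _ ≤ 1 := (div_le_one hB0).2 hΛB
    rw [← hlaw k] at h1
    exact ae_of_ae_map (hz k).aemeasurable h1
  have hm : ∀ k, ∫ ω, g (z k ω) ∂P = 0 := by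
    intro k
    rw [← integral_map (f := g) (hz k).aemeasurable hgc.aestronglyMeasurable, hlaw k, hg,
      integral_smul, integral_sub (integrable_dyad hL hμ) (integrable_const _)]
    simp [hD]
  have hv : ∀ k, ∫ ω, ‖g (z k ω)‖ ^ 2 ∂P ≤ l ^ 2 * B ^ 2 := by
    intro k
    rw [← integral_map (f := fun x => ‖g x‖ ^ 2) (hz k).aemeasurable
      (hgc.norm.pow 2).aestronglyMeasurable, hlaw k]
    simp only [hgn, mul_pow]
    rw [integral_const_mul]
    exact mul_le_mul_of_nonneg_left (integral_norm_dyad_sub_sq_le hL hμ) (by positivity)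
  have hgi : iIndepFun (fun k => g ∘ z k) P := hind.comp (fun _ => g) fun _ => hgc.measurable
  have htail := measure_norm_sum_ge_le (Y := fun k => g ∘ z k)
    (fun k => hgc.measurable.comp (hz k)) hgi hb hm hv
    (τ := l * (N * (7 / 8 * Λ))) (by positivity)
  have hset : {ω | N * (7 / 8 * Λ) ≤ ‖∑ k, (dyad n (z k ω) - D)‖} =
      {ω | l * (N * (7 / 8 * Λ)) ≤ ‖∑ k, (g ∘ z k) ω‖} := by
    ext ω
    have h1 : ∑ k, (g ∘ z k) ω = (l : ℂ) • ∑ k, (dyad n (z k ω) - D) := by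
      rw [Finset.smul_sum]
      rfl
    rw [Set.mem_ofPred_eq, Set.mem_ofPred_eq, h1, norm_smul, Complex.norm_real,
      Real.norm_of_nonneg hl0.le, mul_le_mul_iff_right₀ hl0]
  rw [hset]
  refine htail.trans (ENNReal.ofReal_le_ofReal ?_)
  have hexp : 3 / 4 * (l ^ 2 * B ^ 2) * N - l * (N * (7 / 8 * Λ)) = -(N * Λ ^ 2 / (4 * B ^ 2)) := by
    rw [hl]
    field_simp
    ring
  have hlog : Real.log (2 / δ) ≤ N * Λ ^ 2 / (4 * B ^ 2) := by
    have h1 : B ^ 2 = L ^ (4 * n) * (Fintype.card (MultiIdx d n) : ℝ) ^ 2 := by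
      rw [hB, mul_pow, ← pow_mul]
      congr 2
      ring
    rw [← h1] at hN
    rw [le_div_iff₀ (by positivity)]
    have h2 := mul_le_mul_of_nonneg_right hN (sq_nonneg Λ)
    calc Real.log (2 / δ) * (4 * B ^ 2) = B ^ 2 / Λ ^ 2 * (4 * Real.log (2 / δ)) * Λ ^ 2 := by
          field_simp
      _ ≤ N * Λ ^ 2 := h2
  rw [hexp]
  calc 2 * Real.exp (-(N * Λ ^ 2 / (4 * B ^ 2))) ≤ 2 * Real.exp (-Real.log (2 / δ)) := by gcongr
    _ = δ := by
        rw [Real.exp_neg, Real.exp_log (by positivity)]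
        field_simp

end Moments

/-! ### Least squares -/

theorem star_dotProduct_self {I : Type*} [Fintype I] (v : I → ℂ) :
    star v ⬝ᵥ v = ((∑ i, ‖v i‖ ^ 2 : ℝ) : ℂ) := by
  push_cast
  exact Finset.sum_congr rfl fun i _ => Complex.conj_mul' (v i)

theorem frobeniusNorm_eq {m n : Type*} [Fintype m] [Fintype n] (A : Matrix m n ℂ) :
    frobeniusNorm A = Real.sqrt (∑ i, ∑ j, ‖A i j‖ ^ 2) := by
  rw [frobeniusNorm, Finset.sum_comm]
  congr 1
  simp only [Matrix.trace, Matrix.diag_apply, Matrix.mul_apply, Matrix.conjTranspose_apply,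
    Complex.re_sum]
  refine Finset.sum_congr rfl fun j _ => Finset.sum_congr rfl fun i _ => ?_
  rw [RCLike.star_def, Complex.conj_mul', ← Complex.ofReal_pow, Complex.ofReal_re]

section LeastSquares

variable {J I : Type*} [Fintype J] [Fintype I] (U : Matrix J I ℂ)

/-- The adjoint of the first Penrose equation reads `U T U = U`, and `U` can be cancelled on the
left because it is injective. -/
theorem conjTranspose_pseudoInverse_mul [DecidableEq I]
    (hU : ∀ c, U.mulVec c = 0 → c = 0) :
    (pseudoInverse U.conjTranspose).conjTranspose * U = 1 := by
  obtain ⟨h1, -, -, -⟩ := pseudoInverse_spec U.conjTranspose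
  set T := (pseudoInverse U.conjTranspose).conjTranspose with hT
  have h2 : U * (T * U) = U := by
    have := congrArg Matrix.conjTranspose h1
    simpa only [Matrix.conjTranspose_mul, Matrix.conjTranspose_conjTranspose, ← hT] using this
  have h3 : ∀ c, (T * U).mulVec c = (1 : Matrix I I ℂ).mulVec c := by
    intro c
    refine sub_eq_zero.1 (hU _ ?_)
    rw [Matrix.mulVec_sub, Matrix.mulVec_mulVec, h2, Matrix.one_mulVec, sub_self]
  exact Matrix.ext_iff_mulVec.2 h3

/-- `U U†` is an orthogonal projection. -/
theorem sum_norm_sq_mulVec_pseudoInverse_le (ρ : J → ℂ) :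
    ∑ k, ‖U.mulVec ((pseudoInverse U.conjTranspose).conjTranspose.mulVec ρ) k‖ ^ 2 ≤
      ∑ k, ‖ρ k‖ ^ 2 := by
  obtain ⟨h1, -, -, h4⟩ := pseudoInverse_spec U.conjTranspose
  set T := (pseudoInverse U.conjTranspose).conjTranspose with hT
  have hQ : (U * T).conjTranspose = U * T := by
    have h5 : U * T = (pseudoInverse U.conjTranspose * U.conjTranspose).conjTranspose := by
      rw [Matrix.conjTranspose_mul, Matrix.conjTranspose_conjTranspose]
    rw [h5, h4, h4]
  have h2 : U * T * U = U := by
    have := congrArg Matrix.conjTranspose h1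
    simpa only [Matrix.conjTranspose_mul, Matrix.conjTranspose_conjTranspose, ← hT,
      ← Matrix.mul_assoc] using this
  rw [Matrix.mulVec_mulVec]
  set Q := U * T with hQdef
  have hQQ : Q * Q = Q := by rw [hQdef, ← Matrix.mul_assoc, h2]
  have h6 : star (Q.mulVec ρ) ⬝ᵥ (ρ - Q.mulVec ρ) = 0 := by
    rw [Matrix.star_mulVec, ← Matrix.dotProduct_mulVec, hQ, Matrix.mulVec_sub,
      Matrix.mulVec_mulVec, hQQ, sub_self, dotProduct_zero]
  have h7 : star (ρ - Q.mulVec ρ) ⬝ᵥ Q.mulVec ρ = 0 := by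
    rw [Matrix.star_dotProduct, h6, star_zero]
  have h8 : star ρ ⬝ᵥ ρ = star (Q.mulVec ρ) ⬝ᵥ Q.mulVec ρ +
      star (ρ - Q.mulVec ρ) ⬝ᵥ (ρ - Q.mulVec ρ) := by
    conv_lhs => rw [← add_sub_cancel (Q.mulVec ρ) ρ]
    rw [star_add, add_dotProduct, dotProduct_add, dotProduct_add, h6, h7]
    ring
  simp only [star_dotProduct_self] at h8
  have h9 : ∑ k, ‖ρ k‖ ^ 2 = ∑ k, ‖Q.mulVec ρ k‖ ^ 2 + ∑ k, ‖(ρ - Q.mulVec ρ) k‖ ^ 2 := by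
    exact_mod_cast h8
  rw [h9]
  exact le_add_of_nonneg_right (Finset.sum_nonneg fun _ _ => by positivity)

end LeastSquares

/-! ### Uniform bounds for the basis functions and the Taylor remainder -/

/-- The simplex of multi-indices is enlarged to a box, where the sum factors into partial sums of
exponential series. The bound is independent of `m`, as the constant in the theorem must be. -/
theorem sum_multiIdx_prod_le {r : ℕ} (m : ℕ) (y : Fin r → ℝ) (hy : ∀ j, 0 ≤ y j) :
    ∑ β : MultiIdx r m, ∏ j, y j ^ β.1 j / (β.1 j).factorial ≤ Real.exp (∑ j, y j) := by
  classical
  calc ∑ β : MultiIdx r m, ∏ j, y j ^ β.1 j / (β.1 j).factorial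
      = ∑ β ∈ Finset.univ.image (fun β : MultiIdx r m => β.1),
          ∏ j, y j ^ β j / (β j).factorial :=
        (Finset.sum_image (s := Finset.univ) (g := fun β : MultiIdx r m => β.1)
          (f := fun β => ∏ j, y j ^ β j / ((β j).factorial : ℝ))
          fun _ _ _ _ h => Subtype.ext h).symm
    _ ≤ ∑ β ∈ Fintype.piFinset fun _ : Fin r => Finset.range (m + 1),
          ∏ j, y j ^ β j / (β j).factorial := by
        refine Finset.sum_le_sum_of_subset_of_nonneg ?_ fun β _ _ =>
          Finset.prod_nonneg fun j _ => div_nonneg (pow_nonneg (hy j) _) (Nat.cast_nonneg _)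
        intro β hβ
        obtain ⟨γ, -, rfl⟩ := Finset.mem_image.1 hβ
        refine Fintype.mem_piFinset.2 fun j => Finset.mem_range.2 (Nat.lt_succ_of_le ?_)
        exact (Finset.single_le_sum (f := γ.1) (fun _ _ => Nat.zero_le _)
          (Finset.mem_univ j)).trans γ.2
    _ = ∏ j, ∑ b ∈ Finset.range (m + 1), y j ^ b / b.factorial :=
        (Finset.prod_univ_sum (fun _ : Fin r => Finset.range (m + 1))
          fun j b => y j ^ b / (b.factorial : ℝ)).symm
    _ ≤ ∏ j, Real.exp (y j) := Finset.prod_le_prod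
        (fun j _ => Finset.sum_nonneg fun b _ => div_nonneg (pow_nonneg (hy j) _)
          (Nat.cast_nonneg _)) fun j _ => Real.sum_le_exp_of_nonneg (hy j) _
    _ = Real.exp (∑ j, y j) := (Real.exp_sum _ _).symm

theorem sum_norm_sq_fockBasisFun_le {r : ℕ} (m : ℕ) (q w : CSpace r) :
    ∑ β : MultiIdx r m, ‖fockBasisFun q β.1 w‖ ^ 2 ≤
      Real.exp (-‖q‖ ^ 2 / 2) ^ 2 * ‖expFun q w‖ ^ 2 * Real.exp (∑ j, ‖w j - q j‖ ^ 2) := by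
  have h1 := sum_multiIdx_prod_le m (fun j => ‖w j - q j‖ ^ 2) fun j => by positivity
  refine le_trans (le_of_eq ?_) (mul_le_mul_of_nonneg_left h1 (by positivity))
  rw [Finset.mul_sum]
  refine Finset.sum_congr rfl fun β _ => ?_
  have h2 : (0 : ℝ) ≤ ((∏ i, (β.1 i).factorial : ℕ) : ℝ) := Nat.cast_nonneg _
  rw [fockBasisFun, norm_mul, norm_mul, norm_prod, Complex.norm_real, Real.norm_of_nonneg
    (div_nonneg (Real.exp_pos _).le (Real.sqrt_nonneg _)), mul_pow, mul_pow, div_pow,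
    Real.sq_sqrt h2, Finset.prod_div_distrib]
  push_cast
  rw [← Finset.prod_pow]
  have h3 : ∀ i, ‖(w i - q i) ^ β.1 i‖ ^ 2 = (‖w i - q i‖ ^ 2) ^ β.1 i := fun i => by
    rw [norm_pow, ← pow_mul, ← pow_mul, mul_comm]
  simp only [h3]
  ring

theorem multiDeriv_sum {d : ℕ} {I : Type*} (s : Finset I) (α : Fin d → ℕ) (c : I → ℂ)
    (g : I → CSpace d → ℂ) {z : CSpace d} (hg : ∀ i, AnalyticAt ℂ (g i) z) :
    multiDeriv α (fun w => ∑ i ∈ s, c i * g i w) z = ∑ i ∈ s, c i * multiDeriv α (g i) z := by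
  classical
  have h0 : multiDeriv α (fun _ : CSpace d => (0 : ℂ)) z = 0 := by
    have h := (pdList_smul (coordList α) 0 (h := fun _ : CSpace d => (0 : ℂ)) (z := z)
      analyticAt_const).eq_of_nhds
    rwa [zero_smul, zero_smul, Pi.zero_apply] at h
  induction s using Finset.induction_on with
  | empty => simpa using h0
  | insert i s hi ih =>
    rw [Finset.sum_insert hi, ← ih]
    have h1 : (fun w => ∑ j ∈ insert i s, c j * g j w) =
        c i • g i + fun w => ∑ j ∈ s, c j * g j w := by
      funext w
      rw [Finset.sum_insert hi]
      rfl
    have h2 : AnalyticAt ℂ (fun w => ∑ j ∈ s, c j * g j w) z :=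
      Finset.analyticAt_fun_sum _ fun j _ => analyticAt_const.mul (hg j)
    rw [h1, multiDeriv, (pdList_add _ ((hg i).const_smul (c := c i)) h2).eq_of_nhds, Pi.add_apply,
      (pdList_smul _ (c i) (hg i)).eq_of_nhds]
    rfl

theorem taylorPoly_sum {d n : ℕ} {I : Type*} [Fintype I] (c : I → ℂ) (g : I → CSpace d → ℂ)
    {p : CSpace d} (hg : ∀ i, AnalyticAt ℂ (g i) p) (x : CSpace d) :
    taylorPoly n (fun w => ∑ i, c i * g i w) p x = ∑ i, c i * taylorPoly n (g i) p x := by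
  simp only [taylorPoly, multiDeriv_sum _ _ c g hg, Finset.mul_sum]
  rw [Finset.sum_comm]
  exact Finset.sum_congr rfl fun i _ => Finset.sum_congr rfl fun α _ => by ring

/-- The remainder of the Taylor expansion of a vector valued function. -/
theorem sqrt_sum_norm_sq_sub_taylorPoly_le {d : ℕ} {I : Type*} [Fintype I]
    (g : I → CSpace d → ℂ) (p x : CSpace d) (n : ℕ) {s M : ℝ} (hs0 : 0 < s) (hs1 : s < 1)
    (hg : ∀ t : ℂ, ‖t‖ ≤ s⁻¹ → ∀ i, AnalyticAt ℂ (g i) (p + t • x))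
    (hM : ∀ t : ℂ, ‖t‖ ≤ s⁻¹ → Real.sqrt (∑ i, ‖g i (p + t • x)‖ ^ 2) ≤ M) :
    Real.sqrt (∑ i, ‖g i (p + x) - taylorPoly n (g i) p x‖ ^ 2) ≤
      M * s ^ (n + 1) / (1 - s) := by
  set ρ : I → ℂ := fun i => g i (p + x) - taylorPoly n (g i) p x with hρ
  set S := Real.sqrt (∑ i, ‖ρ i‖ ^ 2) with hS
  have hS0 : 0 ≤ S := Real.sqrt_nonneg _
  have hSS : S * S = ∑ i, ‖ρ i‖ ^ 2 :=
    Real.mul_self_sqrt (Finset.sum_nonneg fun _ _ => by positivity)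
  have hM0 : 0 ≤ M := (Real.sqrt_nonneg _).trans (hM 0 (by simpa using hs0.le))
  -- Duality: pairing the vector `g` with its own remainder `ρ` gives a scalar function bounded by
  -- `S * M`, whose remainder at `p + x` is exactly `S²`. Dividing the scalar estimate by `S` gives
  -- the vector estimate with no factor for the number of components.
  set h : CSpace d → ℂ := fun w => ∑ i, starRingEnd ℂ (ρ i) * g i w with hh
  have h1 := norm_sub_taylorPoly_le (h := h) p x n (M := S * M) hs0 hs1
    (fun t ht => Finset.analyticAt_fun_sum _ fun i _ => analyticAt_const.mul (hg t ht i))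
    (fun t ht => by
      calc ‖∑ i, starRingEnd ℂ (ρ i) * g i (p + t • x)‖
          ≤ ∑ i, ‖starRingEnd ℂ (ρ i) * g i (p + t • x)‖ := norm_sum_le _ _
        _ = ∑ i, ‖ρ i‖ * ‖g i (p + t • x)‖ := by simp only [norm_mul, RCLike.norm_conj]
        _ ≤ S * Real.sqrt (∑ i, ‖g i (p + t • x)‖ ^ 2) :=
            Real.sum_mul_le_sqrt_mul_sqrt _ _ _
        _ ≤ S * M := mul_le_mul_of_nonneg_left (hM t ht) hS0)
  have hgp : ∀ i, AnalyticAt ℂ (g i) p := fun i => by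
    simpa using hg 0 (by simpa using hs0.le) i
  have h2 : h (p + x) - taylorPoly n h p x = ((S * S : ℝ) : ℂ) := by
    rw [hh, taylorPoly_sum _ _ hgp, ← Finset.sum_sub_distrib, hSS]
    push_cast
    refine Finset.sum_congr rfl fun i _ => ?_
    rw [← mul_sub, ← Complex.conj_mul']
  rw [h2, Complex.norm_real, Real.norm_of_nonneg (mul_nonneg hS0 hS0)] at h1
  have hB : 0 ≤ M * s ^ (n + 1) / (1 - s) :=
    div_nonneg (mul_nonneg hM0 (by positivity)) (sub_nonneg.2 hs1.le)
  rcases hS0.eq_or_lt with h0 | h0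
  · rw [← h0]; exact hB
  · refine le_of_mul_le_mul_left ?_ h0
    calc S * S ≤ S * M * s ^ (n + 1) / (1 - s) := h1
      _ = S * (M * s ^ (n + 1) / (1 - s)) := by ring

/-- Writing `x = b y` with `y ∈ K₀` and `b < s`, the complex scalar `t b` has modulus at most `1`.
So the whole disc of radius `s⁻¹` in the complex line through `x` stays in `K₀`, as Cauchy's
estimate requires. -/
theorem IsAbsConvex.smul_mem_of_gauge_lt {d : ℕ} {K₀ : Set (CSpace d)} (hK : IsAbsConvex K₀)
    (h0 : K₀ ∈ 𝓝 0) {x : CSpace d} {s : ℝ} (hx : gauge K₀ x < s) {t : ℂ} (ht : ‖t‖ ≤ s⁻¹) :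
    t • x ∈ K₀ := by
  obtain ⟨b, hb0, hbs, y, hy, rfl⟩ := exists_lt_of_gauge_lt (absorbent_nhds_zero h0) hx
  have h1 := hK y hy y hy (t * b) 0 (by
    rw [norm_zero, add_zero, norm_mul, Complex.norm_real, Real.norm_of_nonneg hb0.le]
    calc ‖t‖ * b ≤ s⁻¹ * s := mul_le_mul ht hbs.le hb0.le (inv_nonneg.2 (hb0.trans hbs).le)
      _ = 1 := inv_mul_cancel₀ (hb0.trans hbs).ne')
  rw [zero_smul, add_zero, mul_smul, Complex.coe_smul] at h1
  exact h1

theorem IsAbsConvex.convex {d : ℕ} {K₀ : Set (CSpace d)} (hK : IsAbsConvex K₀) :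
    Convex ℝ K₀ := by
  intro x hx y hy a b ha hb hab
  have := hK x hx y hy a b (by
    rw [Complex.norm_real, Complex.norm_real, Real.norm_of_nonneg ha, Real.norm_of_nonneg hb, hab])
  rwa [Complex.coe_smul, Complex.coe_smul] at this

theorem sqrt_sum_norm_sq_sub_taylorPoly_le_of_gauge_le {d : ℕ} {K₀ : Set (CSpace d)}
    (hK : IsAbsConvex K₀) (h0 : K₀ ∈ 𝓝 0) {I : Type*} [Fintype I]
    (g : I → CSpace d → ℂ) (p x : CSpace d) (n : ℕ) {R M : ℝ} (hR0 : 0 ≤ R) (hR1 : R < 1)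
    (hg : ∀ i, AnalyticOnNhd ℂ (g i) (p +ᵥ K₀))
    (hM : ∀ z ∈ p +ᵥ K₀, Real.sqrt (∑ i, ‖g i z‖ ^ 2) ≤ M) (hx : gauge K₀ x ≤ R) :
    Real.sqrt (∑ i, ‖g i (p + x) - taylorPoly n (g i) p x‖ ^ 2) ≤
      M * R ^ (n + 1) / (1 - R) := by
  have hmem : ∀ s, R < s → ∀ t : ℂ, ‖t‖ ≤ s⁻¹ → p + t • x ∈ p +ᵥ K₀ := fun s hs t ht =>
    ⟨t • x, hK.smul_mem_of_gauge_lt h0 (hx.trans_lt hs) ht, rfl⟩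
  -- Membership in `K₀` needs `gauge K₀ x < s` and Cauchy's estimate needs `s > 0`, so the bound is
  -- obtained for `s > R` and passed to the limit; this includes `R = 0`.
  have hc : Tendsto (fun s : ℝ => M * s ^ (n + 1) / (1 - s)) (𝓝[>] R)
      (𝓝 (M * R ^ (n + 1) / (1 - R))) := by
    refine ContinuousAt.continuousWithinAt (s := Set.Ioi R) ?_
    exact ContinuousAt.div (by fun_prop) (by fun_prop) (sub_pos.2 hR1).ne'
  refine ge_of_tendsto hc ?_
  filter_upwards [Ioo_mem_nhdsGT hR1] with s hs
  exact sqrt_sum_norm_sq_sub_taylorPoly_le g p x n (hR0.trans_lt hs.1) hs.2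
    (fun t ht i => hg i _ (hmem s hs.1 t ht)) (fun t ht => hM _ (hmem s hs.1 t ht))

/-! ### The deterministic error estimate -/

/-- The normalizing constant of `u_{p,α}`. -/
def fockWeight {d : ℕ} (p : CSpace d) (α : Fin d → ℕ) : ℝ :=
  Real.exp (-‖p‖ ^ 2 / 2) / Real.sqrt (∏ i, (α i).factorial : ℕ)

theorem fockWeight_sq {d : ℕ} (p : CSpace d) (α : Fin d → ℕ) :
    fockWeight p α ^ 2 = Real.exp (-‖p‖ ^ 2 / 2) ^ 2 / (∏ i, (α i).factorial : ℕ) := by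
  rw [fockWeight, div_pow, Real.sq_sqrt (Nat.cast_nonneg _)]

theorem prod_factorial_pos {d : ℕ} (α : Fin d → ℕ) : 0 < ∏ i, (α i).factorial :=
  Finset.prod_pos fun _ _ => Nat.factorial_pos _

theorem fockWeight_pos {d : ℕ} (p : CSpace d) (α : Fin d → ℕ) : 0 < fockWeight p α :=
  div_pos (Real.exp_pos _) (Real.sqrt_pos.2 (Nat.cast_pos.2 (prod_factorial_pos α)))

/-- The product of the factorials divides `|α|!`, which is at most `m!`. This is the source of
`√(m!)` in the final bound. -/
theorem le_fockWeight_sq {d m : ℕ} (p : CSpace d) (α : MultiIdx d m) :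
    Real.exp (-‖p‖ ^ 2 / 2) ^ 2 / m.factorial ≤ fockWeight p α.1 ^ 2 := by
  rw [fockWeight_sq]
  have h1 : ∏ i, (α.1 i).factorial ≤ m.factorial :=
    (Nat.le_of_dvd (Nat.factorial_pos _) (Nat.prod_factorial_dvd_factorial_sum _ _)).trans
      (Nat.factorial_le α.2)
  have h2 : (0 : ℝ) < ((∏ i, (α.1 i).factorial : ℕ) : ℝ) := Nat.cast_pos.2 (prod_factorial_pos _)
  gcongr

theorem fockBasisFun_add {d n : ℕ} (p x : CSpace d) (α : MultiIdx d n) :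
    fockBasisFun p α.1 (p + x) = expFun p (p + x) * (fockWeight p α.1 * mono x α) := by
  rw [fockBasisFun, fockWeight, mono]
  simp only [PiLp.add_apply, add_sub_cancel_left]
  ring

theorem fockCoeff_mul_fockWeight {d n : ℕ} (p : CSpace d) (α : MultiIdx d n)
    (h : CSpace d → ℂ) :
    fockWeight p α.1 * fockCoeff p α.1 h =
      multiDeriv α.1 (fun w => expFun (-p) w * h w) p / (∏ i, (α.1 i).factorial : ℕ) := by
  have h1 : fockWeight p α.1 * (Real.exp (‖p‖ ^ 2 / 2) /
      Real.sqrt (∏ i, (α.1 i).factorial : ℕ)) = ((∏ i, (α.1 i).factorial : ℕ) : ℝ)⁻¹ := by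
    rw [fockWeight, div_mul_div_comm, ← Real.exp_add, Real.mul_self_sqrt (Nat.cast_nonneg _),
      neg_div, neg_add_cancel, Real.exp_zero, one_div]
  rw [fockCoeff, ← mul_assoc, ← Complex.ofReal_mul, h1, Complex.ofReal_inv, Complex.ofReal_natCast]
  ring

/-- The expansion of `h` in the functions `u_{p,α}` is the Taylor expansion of `e_{-p} h`. -/
theorem sum_fockBasisFun_mul_fockCoeff {d n : ℕ} (p x : CSpace d) (h : CSpace d → ℂ) :
    ∑ α : MultiIdx d n, fockBasisFun p α.1 (p + x) * fockCoeff p α.1 h =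
      expFun p (p + x) * taylorPoly n (fun w => expFun (-p) w * h w) p x := by
  rw [taylorPoly, Finset.mul_sum]
  refine Finset.sum_congr rfl fun α _ => ?_
  have h1 := fockCoeff_mul_fockWeight p α h
  rw [fockBasisFun_add]
  calc _ = expFun p (p + x) * mono x α * (fockWeight p α.1 * fockCoeff p α.1 h) := by ring
    _ = _ := by
      rw [h1, mono]
      ring

section Sample

variable {d N : ℕ} {p : CSpace d} {n : ℕ} {x : Fin N → CSpace d} {e₀ A : ℝ}

/-- `U` factors as the diagonal of the values `e_p (p + x k)`, the monomial matrix and the diagonal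
of weights. The weights are kept on the left side so that they can be estimated for `|α| ≤ m` only.
-/
theorem le_sum_norm_sq_dataMatrix_mulVec (he₀ : 0 ≤ e₀)
    (he : ∀ k, e₀ ≤ ‖expFun p (p + x k)‖)
    (hA : ∀ c : MultiIdx d n → ℂ,
      A * ∑ α, ‖c α‖ ^ 2 ≤ ∑ k, ‖∑ α, c α * mono (x k) α‖ ^ 2) (c : MultiIdx d n → ℂ) :
    e₀ ^ 2 * A * ∑ α, fockWeight p α.1 ^ 2 * ‖c α‖ ^ 2 ≤
      ∑ k, ‖(dataMatrix p n fun k => p + x k).mulVec c k‖ ^ 2 := by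
  have h1 := hA fun α => fockWeight p α.1 * c α
  have h2 : ∑ α : MultiIdx d n, ‖(fockWeight p α.1 : ℂ) * c α‖ ^ 2 =
      ∑ α, fockWeight p α.1 ^ 2 * ‖c α‖ ^ 2 := by
    refine Finset.sum_congr rfl fun α _ => ?_
    rw [norm_mul, Complex.norm_real, Real.norm_of_nonneg (fockWeight_pos p α.1).le, mul_pow]
  rw [h2] at h1
  rw [mul_assoc]
  refine (mul_le_mul_of_nonneg_left h1 (sq_nonneg e₀)).trans ?_
  rw [Finset.mul_sum]
  refine Finset.sum_le_sum fun k _ => ?_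
  have h3 : (dataMatrix p n fun k => p + x k).mulVec c k =
      expFun p (p + x k) * ∑ α, fockWeight p α.1 * c α * mono (x k) α := by
    rw [Finset.mul_sum]
    refine Finset.sum_congr rfl fun α _ => ?_
    change fockBasisFun p α.1 (p + x k) * c α = _
    rw [fockBasisFun_add]
    ring
  rw [h3, norm_mul, mul_pow]
  exact mul_le_mul_of_nonneg_right (pow_le_pow_left₀ he₀ (he k) 2) (by positivity)

/-- Only the rows with `|α| ≤ m` enter the error, so discarding the others before bounding the
weights costs `m!` rather than `n!`. -/
theorem sum_castLE_le {m : ℕ} (hmn : m ≤ n) (y : MultiIdx d n → ℂ) :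
    Real.exp (-‖p‖ ^ 2 / 2) ^ 2 / m.factorial * ∑ α : MultiIdx d m, ‖y (α.castLE hmn)‖ ^ 2 ≤
      ∑ α : MultiIdx d n, fockWeight p α.1 ^ 2 * ‖y α‖ ^ 2 := by
  calc _ ≤ ∑ α : MultiIdx d m, fockWeight p (α.castLE hmn).1 ^ 2 * ‖y (α.castLE hmn)‖ ^ 2 := by
        rw [Finset.mul_sum]
        exact Finset.sum_le_sum fun α _ =>
          mul_le_mul_of_nonneg_right (le_fockWeight_sq p α) (by positivity)
    _ = ∑ α ∈ Finset.univ.image (MultiIdx.castLE hmn), fockWeight p α.1 ^ 2 * ‖y α‖ ^ 2 :=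
        (Finset.sum_image (s := Finset.univ) (g := MultiIdx.castLE hmn)
          (f := fun α : MultiIdx d n => fockWeight p α.1 ^ 2 * ‖y α‖ ^ 2)
          fun α _ β _ h => Subtype.ext (congrArg (fun γ : MultiIdx d n => γ.1) h)).symm
    _ ≤ _ := Finset.sum_le_sum_of_subset_of_nonneg (Finset.subset_univ _)
        fun _ _ _ => by positivity

variable {r m : ℕ} {S : Set (CSpace d)}

/-- Least squares perturbation: the true coefficients `a` are reproduced exactly by `T U = 1`, so
the error is `T` applied to the Taylor remainder `ρ`, and `U T` does not increase norms. -/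
theorem frobeniusNorm_sub_sq_le (hp : p ∈ S) (f : CSpace d → CSpace r)
    (hf : AnalyticOnNhd ℂ f S) (hmn : m ≤ n) (he₀ : 0 < e₀) (hA0 : 0 < A)
    (he : ∀ k, e₀ ≤ ‖expFun p (p + x k)‖)
    (hA : ∀ c : MultiIdx d n → ℂ,
      A * ∑ α, ‖c α‖ ^ 2 ≤ ∑ k, ‖∑ α, c α * mono (x k) α‖ ^ 2) {e₁ Q : ℝ}
    (he₁ : ∀ k, ‖expFun p (p + x k)‖ ≤ e₁)
    (hQ : ∀ k, Real.sqrt (∑ β : MultiIdx r m,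
      ‖expFun (-p) (p + x k) * fockBasisFun (f p) β.1 (f (p + x k)) -
        taylorPoly n (fun w => expFun (-p) w * fockBasisFun (f p) β.1 (f w)) p (x k)‖ ^ 2) ≤ Q) :
    e₀ ^ 2 * A * (Real.exp (-‖p‖ ^ 2 / 2) ^ 2 / m.factorial) *
      frobeniusNorm (pushforwardMatrix hp f hf m -
        empiricalMatrix p f hmn fun k => p + x k) ^ 2 ≤ N * (e₁ ^ 2 * Q ^ 2) := by
  set U := dataMatrix p n fun k => p + x k with hUdef
  set V := dataMatrix (f p) m fun k => f (p + x k) with hV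
  set T := (pseudoInverse U.conjTranspose).conjTranspose with hT
  set a : Matrix (MultiIdx d n) (MultiIdx r m) ℂ :=
    Matrix.of fun α β => fockCoeff p α.1 (fockBasisFun (f p) β.1 ∘ f) with ha
  set ρ : Matrix (Fin N) (MultiIdx r m) ℂ := V - U * a with hρ
  have hlow := le_sum_norm_sq_dataMatrix_mulVec (n := n) he₀.le he hA
  rw [← hUdef] at hlow
  -- The lower bound has strictly positive constants and weights, hence forces injectivity.
  have hinj : ∀ c, U.mulVec c = 0 → c = 0 := by
    intro c hc
    have h1 := hlow c
    simp only [hc, Pi.zero_apply, norm_zero, ne_eq, OfNat.ofNat_ne_zero, not_false_eq_true,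
      zero_pow, Finset.sum_const_zero] at h1
    have h2 : ∑ α, fockWeight p α.1 ^ 2 * ‖c α‖ ^ 2 ≤ 0 := by
      by_contra! h
      exact absurd h1 (not_le.2 (by positivity))
    have h3 := (Finset.sum_eq_zero_iff_of_nonneg fun α _ => by positivity).1
      (le_antisymm h2 (Finset.sum_nonneg fun α _ => by positivity))
    funext α
    have h4 := h3 α (Finset.mem_univ α)
    have h5 := fockWeight_pos p α.1
    simpa [h5.ne'] using h4
  have hTU : T * U = 1 := conjTranspose_pseudoInverse_mul U hinj
  have hTV : T * V = a + T * ρ := by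
    rw [hρ, Matrix.mul_sub, ← Matrix.mul_assoc, hTU, Matrix.one_mul, add_sub_cancel]
  have hentry : ∀ β α, ‖(pushforwardMatrix hp f hf m -
      empiricalMatrix p f hmn fun k => p + x k) β α‖ = ‖(T * ρ) (α.castLE hmn) β‖ := by
    intro β α
    have h1 : starRingEnd ℂ (empiricalMatrix p f hmn (fun k => p + x k) β α) =
        (T * V) (α.castLE hmn) β := by
      have h2 : T * V = (V.conjTranspose * pseudoInverse U.conjTranspose).conjTranspose := by
        rw [Matrix.conjTranspose_mul, Matrix.conjTranspose_conjTranspose]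
      rw [h2]
      rfl
    rw [← RCLike.norm_conj, Matrix.sub_apply, map_sub, h1, conj_pushforwardMatrix, hTV,
      Matrix.add_apply]
    have h3 : a (α.castLE hmn) β = fockCoeff p α.1 (fockBasisFun (f p) β.1 ∘ f) := rfl
    rw [h3, sub_add_cancel_left, norm_neg]
  -- The Taylor expansion is that of `e_{-p} (v_{q,β} ∘ f)`; multiplying back by `e_p` recovers the
  -- residual of the linear system.
  have hrem : ∀ k β, ρ k β = expFun p (p + x k) *
      (expFun (-p) (p + x k) * fockBasisFun (f p) β.1 (f (p + x k)) -
        taylorPoly n (fun w => expFun (-p) w * fockBasisFun (f p) β.1 (f w)) p (x k)) := by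
    intro k β
    have h1 : (U * a) k β = expFun p (p + x k) *
        taylorPoly n (fun w => expFun (-p) w * fockBasisFun (f p) β.1 (f w)) p (x k) :=
      sum_fockBasisFun_mul_fockCoeff p (x k) _
    have h2 : expFun p (p + x k) * expFun (-p) (p + x k) = 1 := by
      rw [mul_comm, expFun_neg_mul_expFun, sub_self]
      simp [expFun]
    rw [hρ, Matrix.sub_apply, h1, mul_sub, ← mul_assoc, h2, one_mul]
    rfl
  have hsum : ∑ β, ∑ k, ‖ρ k β‖ ^ 2 ≤ N * (e₁ ^ 2 * Q ^ 2) := by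
    rw [Finset.sum_comm]
    have h1 : ∀ k, ∑ β, ‖ρ k β‖ ^ 2 ≤ e₁ ^ 2 * Q ^ 2 := by
      intro k
      simp only [hrem, norm_mul, mul_pow]
      rw [← Finset.mul_sum]
      refine mul_le_mul (pow_le_pow_left₀ (norm_nonneg _) (he₁ k) 2) ?_
        (Finset.sum_nonneg fun _ _ => by positivity) (by positivity)
      exact (Real.sqrt_le_left ((Real.sqrt_nonneg _).trans (hQ k))).1 (hQ k)
    calc ∑ k, ∑ β, ‖ρ k β‖ ^ 2 ≤ ∑ _k : Fin N, e₁ ^ 2 * Q ^ 2 := Finset.sum_le_sum fun k _ => h1 k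
      _ = N * (e₁ ^ 2 * Q ^ 2) := by simp
  rw [frobeniusNorm_eq, Real.sq_sqrt (Finset.sum_nonneg fun _ _ =>
    Finset.sum_nonneg fun _ _ => by positivity)]
  simp only [hentry]
  refine le_trans ?_ hsum
  rw [Finset.mul_sum]
  refine Finset.sum_le_sum fun β _ => ?_
  rw [mul_assoc]
  -- Column by column: restore all rows `|α| ≤ n`, apply the lower bound for `U`, then the
  -- contraction property of the projection `U T`.
  calc _ ≤ e₀ ^ 2 * A * ∑ α : MultiIdx d n, fockWeight p α.1 ^ 2 * ‖(T * ρ) α β‖ ^ 2 :=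
        mul_le_mul_of_nonneg_left (sum_castLE_le hmn fun α => (T * ρ) α β) (by positivity)
    _ ≤ ∑ k, ‖U.mulVec (T.mulVec fun k => ρ k β) k‖ ^ 2 := hlow (T.mulVec fun k => ρ k β)
    _ ≤ ∑ k, ‖ρ k β‖ ^ 2 := sum_norm_sq_mulVec_pseudoInverse_le U fun k => ρ k β

end Sample

/-! ### Constants attached to the sampling measure -/

theorem isCompact_support {d : ℕ} {K₀ : Set (CSpace d)} (hK₀ : IsCompact K₀)
    {μ : Measure (CSpace d)} (hμ : μ.support ⊆ interior K₀) : IsCompact μ.support :=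
  hK₀.of_isClosed_subset Measure.isClosed_support (hμ.trans interior_subset)

theorem gauge_le_gaugeRadius {d : ℕ} {K₀ : Set (CSpace d)} {μ : Measure (CSpace d)}
    (hμ : μ.support ⊆ interior K₀) {x : CSpace d} (hx : x ∈ μ.support) :
    gauge K₀ x ≤ gaugeRadius K₀ μ := by
  refine le_csSup ⟨1, ?_⟩ (Set.mem_image_of_mem _ hx)
  rintro _ ⟨y, hy, rfl⟩
  exact gauge_le_one_of_mem (interior_subset (hμ hy))

theorem gaugeRadius_nonneg {d : ℕ} (K₀ : Set (CSpace d)) (μ : Measure (CSpace d)) :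
    0 ≤ gaugeRadius K₀ μ :=
  Real.sSup_nonneg (by rintro _ ⟨y, -, rfl⟩; exact gauge_nonneg y)

/-- The continuous gauge attains its supremum on the compact support, and at interior points of `K₀`
it is less than `1`. -/
theorem gaugeRadius_lt_one {d : ℕ} {K₀ : Set (CSpace d)} (hK₀ : IsCompact K₀)
    (hc : Convex ℝ K₀) (h0 : K₀ ∈ 𝓝 0) {μ : Measure (CSpace d)} [IsProbabilityMeasure μ]
    (hμ : μ.support ⊆ interior K₀) : gaugeRadius K₀ μ < 1 := by
  have hne : μ.support.Nonempty := Measure.nonempty_support (IsProbabilityMeasure.ne_zero μ)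
  obtain ⟨x, hx, hxs⟩ := (isCompact_support hK₀ hμ).exists_sSup_image_eq hne
    (continuous_gauge hc h0).continuousOn
  rw [gaugeRadius, hxs]
  exact interior_subset_gauge_lt_one K₀ (hμ hx)

theorem norm_le_coordBound {d : ℕ} {K₀ : Set (CSpace d)} (hK₀ : IsCompact K₀)
    {μ : Measure (CSpace d)} (hμ : μ.support ⊆ interior K₀) {x : CSpace d} (hx : x ∈ μ.support)
    (i : Fin d) : ‖x i‖ ≤ coordBound μ := by
  obtain ⟨C, hC⟩ := hK₀.isBounded.exists_norm_le
  -- Boundedness is essential here, since the real supremum of an unbounded set is `0` by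
  -- convention.
  have hbdd : BddAbove {t : ℝ | ∃ z ∈ μ.support, ∃ i, t = ‖z i‖} := by
    refine ⟨C, ?_⟩
    rintro _ ⟨y, hy, j, rfl⟩
    exact (PiLp.norm_apply_le y j).trans (hC y (interior_subset (hμ hy)))
  exact (le_csSup hbdd ⟨x, hx, i, rfl⟩).trans (le_max_right _ _)

theorem exists_exp_le_norm_expFun_le {d : ℕ} (p : CSpace d) {K : Set (CSpace d)}
    (hK : IsCompact K) :
    ∃ b : ℝ, ∀ z ∈ K, Real.exp (-b) ≤ ‖expFun p z‖ ∧ ‖expFun p z‖ ≤ Real.exp b := by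
  obtain ⟨C, hC⟩ := hK.exists_bound_of_continuousOn (f := fun z => inner ℂ p z)
    (by fun_prop)
  refine ⟨C, fun z hz => ?_⟩
  have h1 := abs_le.1 ((Complex.abs_re_le_norm _).trans (hC z hz))
  rw [expFun, Complex.norm_exp]
  exact ⟨Real.exp_le_exp.2 h1.1, Real.exp_le_exp.2 h1.2⟩

theorem exists_sqrt_sum_fockBasisFun_le {d r : ℕ} (p : CSpace d) {K : Set (CSpace d)}
    (hK : IsCompact K) (f : CSpace d → CSpace r) (hf : ContinuousOn f K) :
    ∃ M : ℝ, 0 < M ∧ ∀ (m : ℕ), ∀ z ∈ K, Real.sqrt (∑ β : MultiIdx r m,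
      ‖expFun (-p) z * fockBasisFun (f p) β.1 (f z)‖ ^ 2) ≤ M := by
  set q := f p with hq
  have he : ∀ {k : ℕ} (ζ : CSpace k), Continuous (expFun ζ) := fun ζ =>
    Complex.continuous_exp.comp (by fun_prop)
  obtain ⟨C, hC⟩ := hK.exists_bound_of_continuousOn (f := fun z => ‖expFun (-p) z‖ ^ 2 *
    (Real.exp (-‖q‖ ^ 2 / 2) ^ 2 * ‖expFun q (f z)‖ ^ 2 * Real.exp (∑ j, ‖f z j - q j‖ ^ 2)))
    (by
      have h1 : ContinuousOn (fun z => expFun q (f z)) K := (he q).comp_continuousOn hf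
      have h2 : ContinuousOn (fun z => Real.exp (∑ j, ‖f z j - q j‖ ^ 2)) K :=
        (by fun_prop : Continuous fun w : CSpace r =>
          Real.exp (∑ j, ‖w j - q j‖ ^ 2)).comp_continuousOn hf
      exact ((he (-p)).continuousOn.norm.pow 2).mul
        ((continuousOn_const.mul (h1.norm.pow 2)).mul h2))
  refine ⟨Real.sqrt (max C 1), Real.sqrt_pos.2 (by positivity), fun m z hz => ?_⟩
  refine Real.sqrt_le_sqrt (le_trans ?_ (le_max_left C 1))
  refine le_trans ?_ ((le_abs_self _).trans (hC z hz))
  simp only [norm_mul, mul_pow]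
  rw [← Finset.mul_sum]
  exact mul_le_mul_of_nonneg_left (sum_norm_sq_fockBasisFun_le m q (f z)) (by positivity)

end FockPushforward

end

/-! ### The probabilistic error bound -/

open FockPushforward
theorem corollary4p6 {d r : ℕ} (p : CSpace d) (K₀ : Set (CSpace d)) (hK₀_compact : IsCompact K₀)
    (hK₀_absConvex : IsAbsConvex K₀) (hK₀_nhds : K₀ ∈ 𝓝 0)
    (f : CSpace d → CSpace r) (hf : AnalyticOnNhd ℂ f (p +ᵥ K₀))
    (μ : Measure (CSpace d)) [IsProbabilityMeasure μ] (hμ : μ.support ⊆ interior K₀) :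
    ∃ C : ℝ, 0 < C ∧
      ∀ (m n : ℕ) (hmn : m ≤ n), IsUnit (momentMatrix n μ) →
      ∀ δ : ℝ, 0 < δ → δ < 1 →
      ∀ N : ℕ, coordBound μ ^ (4 * n) * (Fintype.card (MultiIdx d n) : ℝ) ^ 2 /
          minEigenvalue n μ ^ 2 * (4 * Real.log (2 / δ)) ≤ (N : ℝ) →
      ∀ {Ω : Type*} [MeasurableSpace Ω] (P : Measure Ω) [IsProbabilityMeasure P]
        (z₀ : Fin N → Ω → CSpace d), (∀ k, Measurable (z₀ k)) → iIndepFun z₀ P →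
        (∀ k, P.map (z₀ k) = μ) →
        ENNReal.ofReal (1 - δ) ≤
          P {ω | frobeniusNorm (pushforwardMatrix (mem_translate p hK₀_nhds) f hf m -
              empiricalMatrix p f hmn (fun k => p + z₀ k ω)) ≤
            C * Real.sqrt (2 * (m.factorial : ℝ)) *
              (gaugeRadius K₀ μ ^ n / Real.sqrt (minEigenvalue n μ))} := by
  have hK : IsCompact (p +ᵥ K₀) := hK₀_compact.vadd p
  obtain ⟨b, hb⟩ := exists_exp_le_norm_expFun_le p hK
  obtain ⟨M, hM0, hM⟩ := exists_sqrt_sum_fockBasisFun_le p hK f hf.continuousOn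
  set R := gaugeRadius K₀ μ with hR
  have hR0 : 0 ≤ R := gaugeRadius_nonneg K₀ μ
  have hR1 : R < 1 := gaugeRadius_lt_one hK₀_compact hK₀_absConvex.convex hK₀_nhds hμ
  have hR1' : 0 < 1 - R := sub_pos.2 hR1
  set κ := Real.exp (-‖p‖ ^ 2 / 2) with hκ
  have hκ0 : 0 < κ := Real.exp_pos _
  have hL : 1 ≤ coordBound μ := le_max_left _ _
  have hsupp : ∀ᵐ x ∂μ, x ∈ μ.support := Measure.support_mem_ae
  have hcoord : ∀ᵐ x ∂μ, ∀ i, ‖x i‖ ≤ coordBound μ := by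
    filter_upwards [hsupp] with x hx using norm_le_coordBound hK₀_compact hμ hx
  -- Here `exp b` and `exp (-b)` bound `|e_p|` on `K`, `M / (1 - R)` comes from the Taylor remainder
  -- and `κ` from the weights. The lower bound `Λ/8` gives `√8 = 2√2`, of which `√2` is absorbed in
  -- `√(2 m!)`.
  refine ⟨2 * Real.exp b * M / (κ * Real.exp (-b) * (1 - R)), by positivity, ?_⟩
  intro m n hmn hunit δ hδ0 hδ1 N hN Ω _ P _ z hz hind hlaw
  have hΛ : 0 < minEigenvalue n μ := minEigenvalue_pos hL hcoord hunit
  set Λ := minEigenvalue n μ with hΛdef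
  -- `N` cancels between the squared residual and the lower bound for `U`, so it has to be nonzero;
  -- the condition on `N` ensures this because `log (2/δ) > 0`.
  have hN0 : (0 : ℝ) < N := by
    refine lt_of_lt_of_le ?_ hN
    have h1 : 0 < Real.log (2 / δ) := Real.log_pos (by rw [lt_div_iff₀ hδ0]; linarith)
    have h2 : (0 : ℝ) < Fintype.card (MultiIdx d n) := Nat.cast_pos.2 Fintype.card_pos
    have h3 : 0 < coordBound μ := zero_lt_one.trans_le hL
    positivity
  set bad : Set Ω := {ω | N * (7 / 8 * Λ) ≤
    ‖∑ k, (dyad n (z k ω) - ∫ y, dyad n y ∂μ)‖} with hbad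
  have hbadm : MeasurableSet bad := by
    refine measurableSet_le measurable_const (Measurable.norm ?_)
    exact Finset.measurable_fun_sum _ fun k _ =>
      ((continuous_dyad n).measurable.comp (hz k)).sub_const _
  have hbadP : P bad ≤ ENNReal.ofReal δ :=
    measure_norm_sum_dyad_sub_ge_le hL hcoord hΛ hδ0 hN P z hz hind hlaw
  have hsample : ∀ᵐ ω ∂P, ∀ k, z k ω ∈ μ.support := by
    refine ae_all_iff.2 fun k => ?_
    rw [← hlaw k] at hsupp
    have h1 := ae_of_ae_map (hz k).aemeasurable hsupp
    rwa [hlaw k] at h1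
  calc ENNReal.ofReal (1 - δ) = 1 - ENNReal.ofReal δ := by
        rw [ENNReal.ofReal_sub _ hδ0.le, ENNReal.ofReal_one]
    _ ≤ 1 - P bad := tsub_le_tsub_left hbadP _
    _ = P badᶜ := (prob_compl_eq_one_sub hbadm).symm
    _ ≤ _ := measure_mono_ae ?_
  -- Only `bad` has been shown measurable; the event in the conclusion is reached by almost sure
  -- inclusion of the complement of `bad`, the null set being where a sample point leaves the
  -- support.
  filter_upwards [hsample] with ω hω (hgood : ω ∉ bad)
  have hgood' : ‖∑ k, (dyad n (z k ω) - ∫ y, dyad n y ∂μ)‖ ≤ N * (7 / 8 * Λ) :=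
    (lt_of_not_ge fun h => hgood h).le
  have hmem : ∀ k, p + z k ω ∈ p +ᵥ K₀ := fun k => ⟨z k ω, interior_subset (hμ (hω k)), rfl⟩
  have hanalytic : ∀ β : MultiIdx r m, AnalyticOnNhd ℂ
      (fun w => expFun (-p) w * fockBasisFun (f p) β.1 (f w)) (p +ᵥ K₀) := fun β w hw =>
    (expFun_analytic (-p) _ w hw).mul
      ((fockBasisFun_analytic (f p) β.1 Set.univ (f w) (Set.mem_univ _)).comp (hf w hw))
  have key := frobeniusNorm_sub_sq_le (mem_translate p hK₀_nhds) f hf hmn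
    (x := fun k => z k ω) (Real.exp_pos (-b)) (by positivity : 0 < N * (Λ / 8))
    (fun k => (hb _ (hmem k)).1)
    (le_sum_norm_sq_of_norm_sum_dyad_sub_le hL hcoord (fun k => z k ω) hgood')
    (fun k => (hb _ (hmem k)).2)
    (fun k => sqrt_sum_norm_sq_sub_taylorPoly_le_of_gauge_le hK₀_absConvex hK₀_nhds
      (fun (β : MultiIdx r m) w => expFun (-p) w * fockBasisFun (f p) β.1 (f w)) p (z k ω) n
      hR0 hR1 hanalytic (hM m) (gauge_le_gaugeRadius hμ (hω k)))
  rw [← hκ] at key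
  set F := frobeniusNorm (pushforwardMatrix (mem_translate p hK₀_nhds) f hf m -
    empiricalMatrix p f hmn fun k => p + z k ω) with hF
  change F ≤ _
  have hm0 : (0 : ℝ) < m.factorial := Nat.cast_pos.2 (Nat.factorial_pos m)
  refine le_of_sq_le_sq ?_ (by positivity)
  set e₀ := Real.exp (-b) with he₀
  set e₁ := Real.exp b with he₁
  have he₀0 : 0 < e₀ := Real.exp_pos _
  -- The remainder is of order `R ^ (n + 1)`; one power of `R` is given away to reach the stated `R
  -- ^ n`.
  have hRn : M * R ^ (n + 1) / (1 - R) ≤ M * R ^ n / (1 - R) := by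
    have : R ^ (n + 1) ≤ R ^ n := pow_le_pow_of_le_one hR0 hR1.le n.le_succ
    gcongr
  have hRn2 : (M * R ^ (n + 1) / (1 - R)) ^ 2 ≤ (M * R ^ n / (1 - R)) ^ 2 :=
    pow_le_pow_left₀ (by positivity) hRn 2
  have hright : (2 * e₁ * M / (κ * e₀ * (1 - R)) * √(2 * (m.factorial : ℝ)) *
      (R ^ n / √Λ)) ^ 2 =
      N * (e₁ ^ 2 * (M * R ^ n / (1 - R)) ^ 2) /
        (e₀ ^ 2 * (N * (Λ / 8)) * (κ ^ 2 / m.factorial)) := by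
    rw [mul_pow, mul_pow, div_pow (R ^ n), Real.sq_sqrt hΛ.le,
      Real.sq_sqrt (by positivity : (0 : ℝ) ≤ 2 * m.factorial)]
    field_simp
    ring
  rw [hright, le_div_iff₀ (by positivity), mul_comm]
  refine key.trans ?_
  gcongr
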